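/- **Setting.** Let $d\in\mathbb N$, $p\in[2,3)$, $T>0$. A *control* on an interval $I$ is a map $\omega$ from $\{(s,t)\in I^2: s\le t\}$ to $[0,\infty)$ with $\omega(s,u)+\omega(u,t)\le\omega(s,t)$ for $s\le u\le t$ in $I$; it is *regular* if $\omega(s,t)\to0$ as $|t-s|\to0$. For $q>0$ and a Banach space $E$: * $V_1^q(I;E)$ is the set of paths $g:I\to E$ of finite $q$-variation for which $(s,t)\mapsto\|g\|^q_{q\text{-var};[s,t]}$ is a regular control; * $V_2^q(I;E)$ is the set of two-index maps $g$ on $\{(s,t)\in I^2:s\le t\}$ having left and right limits in each variable, such that $|g_{st}|\le\omega(s,t)^{1/q}$ for all $s\le t$ in $I$, for some regular control $\omega$ on $I$; * $V_{2,\mathrm{loc}}^q(I;E)$ is the set of two-index maps $g$ on $\{(s,t)\in I^2:s\le t\}$ for which $I$ is covered by countably many intervals $I_k\subseteq I$ with $g\in V_2^q(I_k;E)$ for every $k$. Write $\delta g_{st}=g_t-g_s$. A *continuous $p$-rough path* is a pair $X=(X^1,X^2)\in V_2^p([0,T];\mathbb R^d)\times V_2^{p/2}([0,T];\mathbb R^{d\times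 d})$ satisfying Chen's relation: for $s\le u\le t$ in $[0,T]$, $$X^1_{st}=X^1_{su}+X^1_{ut},\qquad X^2_{st}-X^2_{su}-X^2_{ut}=X^1_{su}\otimes X^1_{ut}.$$ It is *geometric* if there are smooth paths $x^n:[0,T]\to\mathbb R^d$ such that $\big(\delta x^n_{st},\int_s^t\delta x^n_{su}\otimes\mathrm dx^n_u\big)$ converges to $X$ in $p$-variation in the first component and $p/2$-variation in the second. For a differentiable $f:\mathbb R\to\mathcal L(\mathbb R^d,\mathbb R)$ with components $f_i(y)=f(y)e_i$ put $$f_2(y)A:=\sum_{i,j=1}^d f_i'(y)\,f_j(y)\,A^{ji},\qquad A\in\mathbb R^{d\times d}.$$ Let $y_{\mathrm{in}}>0$. A *solution* of the rough differential equation reflected at $0$, $$\mathrm dy_t=f(y_t)\,\mathrm dX_t+\mathrm dm_t,\qquad y_t\,\mathrm dm_t=0,$$ with initial condition $y_{\mathrm{in}}$ is a pair of $y\in V_1^p([0,T];\mathbb R_{\ge0})$ and a nondecreasing $m\in V_1^1([0,T];\mathbb R_{\ge0})$ for which there is $y^\natural\in V_{2,\mathrm{loc}}^{p/3}([0,T];\mathbb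 R)$ such that, for all $s\le t$ in $[0,T]$, $$\delta y_{st}=f(y_s)X^1_{st}+f_2(y_s)X^2_{st}+\delta m_{st}+y^\natural_{st},\qquad y_0=y_{\mathrm{in}},\qquad m_t=\int_{[0,t]}\mathbf 1_{\{y_u=0\}}\,\mathrm dm_u,$$ where $\mathrm dm$ is the measure on $[0,T]$ with $m([0,t])=m_t$. **Theorem 4.2.** Let $X$ be a continuous geometric $p$-rough path on $[0,T]$, let $f\in C_b^3(\mathbb R;\mathcal L(\mathbb R^d,\mathbb R))$ (three times continuously differentiable, bounded together with its derivatives up to order three), and let $y_{\mathrm{in}}>0$. Then there exists a solution $(y,m)$ of the reflected equation on $[0,T]$ with initial condition $y_{\mathrm{in}}$, and it is unique: any two solutions with the same initial condition coincide on $[0,T]$. -/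

import Mathlib

open Set Filter Topology
open scoped ENNReal

namespace RRDE

/-- `ℝ^d` with its Euclidean norm. -/
abbrev Vec (d : ℕ) : Type := EuclideanSpace ℝ (Fin d)

/-- `ℝ^{d × d}` with its Euclidean (Frobenius) norm; the entry of index `(i, j)` of `a` is
`a (i, j)`. -/
abbrev Mat (d : ℕ) : Type := EuclideanSpace ℝ (Fin d × Fin d)

/-- The increment `(s, t) ↦ g t - g s` of a path. -/
def incr {E : Type*} [NormedAddCommGroup E] (g : ℝ → E) : ℝ → ℝ → E :=
  fun s t => g t - g s

/-- A control on `I`: a nonnegative superadditive map on `{(s, t) ∈ I × I : s ≤ t}`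
(the values elsewhere are irrelevant). -/
structure IsControl (I : Set ℝ) (ω : ℝ → ℝ → ℝ) : Prop where
  nonneg : ∀ s ∈ I, ∀ t ∈ I, s ≤ t → 0 ≤ ω s t
  superadd : ∀ s ∈ I, ∀ u ∈ I, ∀ t ∈ I, s ≤ u → u ≤ t → ω s u + ω u t ≤ ω s t

/-- `ω (s, t) → 0` as `|t - s| → 0`, for `s ≤ t` in `I`. -/
def IsRegular (I : Set ℝ) (ω : ℝ → ℝ → ℝ) : Prop :=
  ∀ ε > 0, ∃ δ > 0, ∀ s ∈ I, ∀ t ∈ I, s ≤ t → t - s < δ → |ω s t| < ε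

/-- The `p`-th power of the `p`-variation on `I` of a two-index map, i.e. the supremum of
`∑ i, ‖g (t_i) (t_{i+1})‖ ^ p` over all finite sequences `t_0 ≤ t_1 ≤ ⋯ ≤ t_n` in `I`. -/
noncomputable def pVar {E : Type*} [NormedAddCommGroup E] (p : ℝ) (I : Set ℝ)
    (g : ℝ → ℝ → E) : ℝ≥0∞ :=
  ⨆ (n : ℕ) (u : {u : ℕ → ℝ // Monotone u ∧ ∀ i, u i ∈ I}),
    ∑ i ∈ Finset.range n, ‖g (u.1 i) (u.1 (i + 1))‖ₑ ^ p

/-- The space `V^p_1(I; E)`: paths of finite `p`-variation on `I` such that the control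
`(s, t) ↦ ‖g‖^p_{p-var; [s, t]}` is regular. -/
def MemV1 {E : Type*} [NormedAddCommGroup E] (p : ℝ) (I : Set ℝ) (g : ℝ → E) : Prop :=
  pVar p I (incr g) ≠ ∞ ∧
    IsRegular I (fun s t => (pVar p (Icc s t) (incr g)).toReal)

/-- `h` has left and right limits along `S` at every point of `S`. -/
def HasOneSidedLimits {E : Type*} [NormedAddCommGroup E] (S : Set ℝ) (h : ℝ → E) : Prop :=
  ∀ x ∈ S, (∃ l, Tendsto h (𝓝[S ∩ Iio x] x) (𝓝 l)) ∧ (∃ r, Tendsto h (𝓝[S ∩ Ioi x] x) (𝓝 r))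

/-- The space `V^p_2(I; E)`: two-index maps on `{(s, t) ∈ I × I : s ≤ t}` with left and right
limits in each variable and with `‖g s t‖ ≤ ω(s, t)^{1/p}` for some regular control `ω` on `I`. -/
def MemV2 {E : Type*} [NormedAddCommGroup E] (p : ℝ) (I : Set ℝ) (g : ℝ → ℝ → E) : Prop :=
  (∀ s ∈ I, HasOneSidedLimits (I ∩ Ici s) (fun t => g s t)) ∧
  (∀ t ∈ I, HasOneSidedLimits (I ∩ Iic t) (fun s => g s t)) ∧
  ∃ ω : ℝ → ℝ → ℝ, IsControl I ω ∧ IsRegular I ω ∧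
    ∀ s ∈ I, ∀ t ∈ I, s ≤ t → ‖g s t‖ ≤ ω s t ^ (1 / p)

/-- The space `V^p_{2,loc}(I; E)`: there is a countable covering of `I` by intervals `J k ⊆ I`
with `g ∈ V^p_2(J k; E)` for every `k`. -/
def MemV2Loc {E : Type*} [NormedAddCommGroup E] (p : ℝ) (I : Set ℝ) (g : ℝ → ℝ → E) : Prop :=
  ∃ J : ℕ → Set ℝ, (∀ k, (J k).OrdConnected ∧ J k ⊆ I) ∧ I ⊆ ⋃ k, J k ∧
    ∀ k, MemV2 p (J k) g

/-- `(X1, X2)` is a continuous `p`-rough path on `[0, T]` with values in `ℝ^d`: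
`X1 ∈ V^p_2`, `X2 ∈ V^{p/2}_2`, and Chen's relation holds, that is `X1` is additive and
`X2 s t - X2 s u - X2 u t = X1 s u ⊗ X1 u t`. -/
structure IsRoughPath {d : ℕ} (p T : ℝ) (X1 : ℝ → ℝ → Vec d) (X2 : ℝ → ℝ → Mat d) : Prop where
  mem_one : MemV2 p (Icc 0 T) X1
  mem_two : MemV2 (p / 2) (Icc 0 T) X2
  chen_one : ∀ s ∈ Icc 0 T, ∀ u ∈ Icc 0 T, ∀ t ∈ Icc 0 T, s ≤ u → u ≤ t →
    X1 s t = X1 s u + X1 u t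
  chen_two : ∀ s ∈ Icc 0 T, ∀ u ∈ Icc 0 T, ∀ t ∈ Icc 0 T, s ≤ u → u ≤ t →
    ∀ i j : Fin d, X2 s t (i, j) - X2 s u (i, j) - X2 u t (i, j) = X1 s u i * X1 u t j

/-- The iterated integral `∫_s^t (x_u - x_s) ⊗ dx_u` of a smooth path `x` on `[0, T]`. -/
noncomputable def iteratedIntegral {d : ℕ} (T : ℝ) (x : ℝ → Vec d) (s t : ℝ) : Mat d :=
  WithLp.toLp 2 fun ij =>
    ∫ u in s..t, (x u ij.1 - x s ij.1) * derivWithin x (Icc 0 T) u ij.2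

/-- A continuous `p`-rough path on `[0, T]` is geometric if it is the limit, in `p`-variation for
the first component and in `p/2`-variation for the second, of the canonical lifts of a sequence
of smooth paths. -/
def IsGeometricRoughPath {d : ℕ} (p T : ℝ) (X1 : ℝ → ℝ → Vec d) (X2 : ℝ → ℝ → Mat d) : Prop :=
  IsRoughPath p T X1 X2 ∧
  ∃ x : ℕ → ℝ → Vec d, (∀ n, ContDiffOn ℝ (⊤ : ℕ∞) (x n) (Icc 0 T)) ∧
    Tendsto (fun n => pVar p (Icc 0 T) (fun s t => incr (x n) s t - X1 s t)) atTop (𝓝 0) ∧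
    Tendsto (fun n => pVar (p / 2) (Icc 0 T) (fun s t => iteratedIntegral T (x n) s t - X2 s t))
      atTop (𝓝 0)

/-- `f ∈ C_b^n(ℝ; F)`: `f` is `n` times continuously differentiable, and `f` and its derivatives
up to order `n` are bounded. -/
def IsCb {F : Type*} [NormedAddCommGroup F] [NormedSpace ℝ F] (n : ℕ) (f : ℝ → F) : Prop :=
  ContDiff ℝ n f ∧ ∀ k ≤ n, ∃ C : ℝ, ∀ x, ‖iteratedDeriv k f x‖ ≤ C

/-- The second order term `f_2(y) A = ∑ i j, f_i'(y) f_j(y) A_{j i}` where `f_i(y) = f(y) e_i`;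
equivalently `f_2(y) (a ⊗ b) = (f'(y) b) (f(y) a)`. -/
noncomputable def secondOrder {d : ℕ} (f : ℝ → Vec d →L[ℝ] ℝ) (y : ℝ) (A : Mat d) : ℝ :=
  ∑ i : Fin d, ∑ j : Fin d,
    deriv f y (EuclideanSpace.single i 1) * f y (EuclideanSpace.single j 1) * A (j, i)

/-- `m_t = ∫_0^t 1_{y_u = 0} dm_u` for all `t ∈ [0, T]`, where `dm` is the measure on `[0, T]`
determined by `m ([0, t]) = m_t`. -/
def IsReflectionTerm (T : ℝ) (y m : ℝ → ℝ) : Prop :=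
  ∃ μ : MeasureTheory.Measure ℝ,
    (∀ t ∈ Icc 0 T, μ (Icc 0 t) = ENNReal.ofReal (m t)) ∧
    ∀ t ∈ Icc 0 T, m t = ∫ u in Icc 0 t, {u | y u = 0}.indicator (fun _ => (1 : ℝ)) u ∂μ

/-- `(y, m)` solves `dy = f(y) dX + dm`, `y dm = 0`, on `[0, T]` with initial condition `y0`
(only the values of `y` and `m` on `[0, T]` matter). -/
structure IsReflectedSolution {d : ℕ} (p T : ℝ) (f : ℝ → Vec d →L[ℝ] ℝ)
    (X1 : ℝ → ℝ → Vec d) (X2 : ℝ → ℝ → Mat d) (y0 : ℝ) (y m : ℝ → ℝ) : Prop where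
  y_mem : MemV1 p (Icc 0 T) y
  y_nonneg : ∀ t ∈ Icc 0 T, 0 ≤ y t
  m_mem : MemV1 1 (Icc 0 T) m
  m_nonneg : ∀ t ∈ Icc 0 T, 0 ≤ m t
  m_mono : MonotoneOn m (Icc 0 T)
  init : y 0 = y0
  dynamics : ∃ r : ℝ → ℝ → ℝ, MemV2Loc (p / 3) (Icc 0 T) r ∧
    ∀ s ∈ Icc 0 T, ∀ t ∈ Icc 0 T, s ≤ t →
      incr y s t = f (y s) (X1 s t) + secondOrder f (y s) (X2 s t) + incr m s t + r s t
  reflection : IsReflectionTerm T y m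

end RRDE

/-! The line is totally ordered, and the flow of `dy = f(y) dX` preserves this order. Everything
follows from carrying the problem along that flow to the terminal time `T`, where the rough drift
disappears.

The flow: the second order expansion `roughExpansion` composes with itself up to an error of order
`ω ^ (3/p)`, by Chen's relation and Taylor's formula, both in the sup norm and in the Lipschitz
seminorm. As `3/p > 1`, the nonlinear sewing lemma `IsApproxFlow.exists_flow` turns it into an exact
flow `φ`; `IsApproxFlow.exists_isFlow` adds that each `φ s t` is increasing and bi-Lipschitz.

Existence: in the coordinate `φ t T (y t)` an unreflected solution is constant, the boundary becomes
the moving curve `φ t T 0`, and reflection is the one-dimensional Skorokhod problem. Its solution is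
explicit: the transported path `v` is the larger of `φ 0 T y0` and the running maximum of the
boundary curve (`exists_running_max`). Pulling back gives `y`. The increments of `m` are sewn
(`exists_additive_sewing`) from the gaps `y t - φ s t (y s)`, which are nonnegative, vanish where
`v` is constant, and are additive up to order `1/p + 1 ≥ 3/p`; here `p ≥ 2` matters.

Uniqueness: for any solution, `φ t T (y t)` moves only in the direction of `m`
(`IsReflectedSolution.pushforward_le`). Given two solutions and a time `t`, start at the last zero
of `y` before `t`, or at `0` if there is none. There `y ≤ z`; afterwards the transport of `y` does
not increase and that of `z` does not decrease, so `y t ≤ z t` (`IsReflectedSolution.le_of_flow`).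
Symmetry gives `y = z`, and then `m - n` has increments of superlinear order in a control, hence
vanishes.

The remainder of a solution is controlled only on the pieces of a countable cover. This is enough,
because a continuous function that is locally nondecreasing to the right off a countable set is
nondecreasing (`le_of_eventually_ge_right_off_countable`). -/

namespace RRDE

/-! ### Controls and functions dominated by them -/

section Control

variable {I : Set ℝ} {ω ω' : ℝ → ℝ → ℝ}

theorem IsControl.self_eq_zero (h : IsControl I ω) {s : ℝ} (hs : s ∈ I) : ω s s = 0 := by
  have h1 := h.nonneg s hs s hs le_rfl
  have h2 := h.superadd s hs s hs s hs le_rfl le_rfl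
  linarith

theorem IsControl.mono_right (h : IsControl I ω) {s u t : ℝ} (hs : s ∈ I) (hu : u ∈ I)
    (ht : t ∈ I) (hsu : s ≤ u) (hut : u ≤ t) : ω s u ≤ ω s t := by
  have h1 := h.nonneg u hu t ht hut
  have h2 := h.superadd s hs u hu t ht hsu hut
  linarith

theorem IsControl.mono_left (h : IsControl I ω) {s u t : ℝ} (hs : s ∈ I) (hu : u ∈ I)
    (ht : t ∈ I) (hsu : s ≤ u) (hut : u ≤ t) : ω u t ≤ ω s t := by
  have h1 := h.nonneg s hs u hu hsu
  have h2 := h.superadd s hs u hu t ht hsu hut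
  linarith

theorem IsControl.subset {J : Set ℝ} (h : IsControl I ω) (hJ : J ⊆ I) : IsControl J ω :=
  ⟨fun s hs t ht => h.nonneg s (hJ hs) t (hJ ht),
    fun s hs u hu t ht => h.superadd s (hJ hs) u (hJ hu) t (hJ ht)⟩

theorem IsRegular.subset {J : Set ℝ} (h : IsRegular I ω) (hJ : J ⊆ I) : IsRegular J ω := by
  intro ε hε
  obtain ⟨δ, hδ, H⟩ := h ε hε
  exact ⟨δ, hδ, fun s hs t ht => H s (hJ hs) t (hJ ht)⟩

theorem IsControl.add (h : IsControl I ω) (h' : IsControl I ω') :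
    IsControl I (fun s t => ω s t + ω' s t) :=
  ⟨fun s hs t ht hst => add_nonneg (h.nonneg s hs t ht hst) (h'.nonneg s hs t ht hst),
    fun s hs u hu t ht hsu hut => by
      have h1 := h.superadd s hs u hu t ht hsu hut
      have h2 := h'.superadd s hs u hu t ht hsu hut
      linarith⟩

theorem IsRegular.add (h : IsRegular I ω) (h' : IsRegular I ω') :
    IsRegular I (fun s t => ω s t + ω' s t) := by
  intro ε hε
  obtain ⟨δ, hδ, H⟩ := h (ε / 2) (half_pos hε)
  obtain ⟨δ', hδ', H'⟩ := h' (ε / 2) (half_pos hε)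
  refine ⟨min δ δ', lt_min hδ hδ', fun s hs t ht hst hd => ?_⟩
  have h1 := H s hs t ht hst (hd.trans_le (min_le_left _ _))
  have h2 := H' s hs t ht hst (hd.trans_le (min_le_right _ _))
  have h3 := abs_add_le (ω s t) (ω' s t)
  linarith

theorem IsControl.const_mul (h : IsControl I ω) {c : ℝ} (hc : 0 ≤ c) :
    IsControl I (fun s t => c * ω s t) :=
  ⟨fun s hs t ht hst => mul_nonneg hc (h.nonneg s hs t ht hst),
    fun s hs u hu t ht hsu hut => by
      have h1 := h.superadd s hs u hu t ht hsu hut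
      nlinarith⟩

theorem IsRegular.const_mul (h : IsRegular I ω) {c : ℝ} (hc : 0 ≤ c) :
    IsRegular I (fun s t => c * ω s t) := by
  intro ε hε
  obtain ⟨δ, hδ, H⟩ := h (ε / (c + 1)) (by positivity)
  refine ⟨δ, hδ, fun s hs t ht hst hd => ?_⟩
  have h1 := H s hs t ht hst hd
  rw [lt_div_iff₀ (by positivity)] at h1
  rw [abs_mul, abs_of_nonneg hc]
  nlinarith [abs_nonneg (ω s t)]

/-- Increments of a nondecreasing function form a control. -/
theorem isControl_of_monotoneOn {v : ℝ → ℝ} (hv : MonotoneOn v I) :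
    IsControl I (fun s t => v t - v s) :=
  ⟨fun _ hs _ ht hst => sub_nonneg.2 (hv hs ht hst), fun _ _ _ _ _ _ _ _ => by linarith⟩

theorem isRegular_of_continuousOn {v : ℝ → ℝ} {a b : ℝ} (hv : ContinuousOn v (Icc a b)) :
    IsRegular (Icc a b) (fun s t => v t - v s) := by
  intro ε hε
  have := isCompact_Icc.uniformContinuousOn_of_continuous hv
  rw [Metric.uniformContinuousOn_iff] at this
  obtain ⟨δ, hδ, H⟩ := this ε hε
  refine ⟨δ, hδ, fun s hs t ht hst hd => ?_⟩
  have := H t ht s hs (by rw [Real.dist_eq, abs_of_nonneg (by linarith)]; exact hd)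
  rwa [Real.dist_eq] at this

theorem IsRegular.exists_le (h : IsRegular I ω) {ε : ℝ} (hε : 0 < ε) :
    ∃ δ > 0, ∀ s ∈ I, ∀ t ∈ I, s ≤ t → t - s < δ → ω s t ≤ ε := by
  obtain ⟨δ, hδ, H⟩ := h ε hε
  exact ⟨δ, hδ, fun s hs t ht hst hd => (le_abs_self _).trans (H s hs t ht hst hd).le⟩

/-- A path whose increments are dominated by a power of a regular control is continuous. -/
theorem continuousOn_of_abs_sub_le {g : ℝ → ℝ} {C γ : ℝ} (hω : ∀ s ∈ I, ∀ t ∈ I, s ≤ t → 0 ≤ ω s t)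
    (hr : IsRegular I ω) (hC : 0 ≤ C) (hγ : 0 < γ)
    (hg : ∀ s ∈ I, ∀ t ∈ I, s ≤ t → |g t - g s| ≤ C * ω s t ^ γ) : ContinuousOn g I := by
  rw [Metric.continuousOn_iff]
  intro x hx ε hε
  obtain ⟨δ, hδ, H⟩ := hr.exists_le (ε := (ε / (2 * (C + 1))) ^ (1 / γ)) (by positivity)
  have key : ∀ s ∈ I, ∀ t ∈ I, s ≤ t → t - s < δ → |g t - g s| < ε := by
    intro s hs t ht hst hd
    have h1 : ω s t ^ γ ≤ ε / (2 * (C + 1)) := by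
      calc ω s t ^ γ ≤ ((ε / (2 * (C + 1))) ^ (1 / γ)) ^ γ :=
            Real.rpow_le_rpow (hω s hs t ht hst) (H s hs t ht hst hd) hγ.le
        _ = _ := by rw [← Real.rpow_mul (by positivity), one_div_mul_cancel hγ.ne', Real.rpow_one]
    calc |g t - g s| ≤ C * ω s t ^ γ := hg s hs t ht hst
      _ ≤ C * (ε / (2 * (C + 1))) := by gcongr
      _ < ε := by
        rw [mul_div_assoc', div_lt_iff₀ (by positivity)]
        nlinarith
  refine ⟨δ, hδ, fun t ht hd => ?_⟩
  rw [Real.dist_eq] at hd ⊢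
  rcases le_total x t with h | h
  · exact key x hx t ht h (lt_of_abs_lt hd)
  · rw [abs_sub_comm]
    exact key t ht x hx h (by rw [abs_sub_comm] at hd; exact lt_of_abs_lt hd)

/-- A function whose increments are bounded below by `-C ω ^ θ` with `θ > 1` is nondecreasing. -/
theorem le_of_sub_ge_neg_rpow {g : ℝ → ℝ} {a b C θ : ℝ} (hab : a ≤ b)
    (hω : IsControl (Icc a b) ω) (hr : IsRegular (Icc a b) ω) (hC : 0 ≤ C) (hθ : 1 < θ)
    (hg : ∀ s ∈ Icc a b, ∀ t ∈ Icc a b, s ≤ t → -(C * ω s t ^ θ) ≤ g t - g s) : g a ≤ g b := by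
  have ha : a ∈ Icc a b := left_mem_Icc.2 hab
  have hb : b ∈ Icc a b := right_mem_Icc.2 hab
  set Ω := ω a b with hΩ
  have hΩ0 : 0 ≤ Ω := hω.nonneg a ha b hb hab
  -- On steps where `ω ≤ ε` the loss is at most `C * ω ^ θ ≤ C * ε ^ (θ - 1) * ω`. Superadditivity
  -- sums these losses to a multiple of `Ω`, and the factor `ε ^ (θ - 1)` then tends to `0`.
  have key : ∀ ε > 0, -(C * ε ^ (θ - 1) * Ω) ≤ g b - g a := by
    intro ε hε
    obtain ⟨δ, hδ, H⟩ := hr.exists_le hε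
    have step : ∀ n : ℕ, ∀ t ∈ Icc a b, t - a ≤ n * (δ / 2) →
        -(C * ε ^ (θ - 1) * ω a t) ≤ g t - g a := by
      intro n
      induction n with
      | zero =>
        intro t ht h
        have : t = a := le_antisymm (by simpa using h) ht.1
        subst this
        rw [hω.self_eq_zero ht]; simp
      | succ n ih =>
        intro t ht h
        set u := max a (t - δ / 2) with hu
        have hua : a ≤ u := le_max_left _ _
        have hut : u ≤ t := max_le ht.1 (by linarith)
        have hu' : u ∈ Icc a b := ⟨hua, hut.trans ht.2⟩
        have h1 := ih u hu' (by
          push_cast at h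
          rcases max_cases a (t - δ / 2) with ⟨h1, _⟩ | ⟨h1, _⟩
          · rw [hu, h1]; simp; positivity
          · rw [hu, h1]; linarith)
        have hsm : ω u t ≤ ε := H u hu' t ht hut (by
          have := le_max_right a (t - δ / 2)
          rw [← hu] at this; linarith)
        have h0 : 0 ≤ ω u t := hω.nonneg u hu' t ht hut
        have h2 := hg u hu' t ht hut
        have h3 : ω u t ^ θ ≤ ε ^ (θ - 1) * ω u t := by
          rcases h0.eq_or_lt with h0 | h0
          · rw [← h0, Real.zero_rpow (by linarith)]; simp
          · rw [show θ = (θ - 1) + 1 by ring, Real.rpow_add h0, Real.rpow_one]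
            simp only [add_sub_cancel_right]
            gcongr
        have h4 := hω.superadd a ha u hu' t ht hua hut
        have h5 : C * ω u t ^ θ ≤ C * (ε ^ (θ - 1) * ω u t) := by gcongr
        have h6 : C * ε ^ (θ - 1) * (ω a u + ω u t) ≤ C * ε ^ (θ - 1) * ω a t := by gcongr
        nlinarith
    obtain ⟨n, hn⟩ := exists_nat_ge ((b - a) / (δ / 2))
    exact step n b hb (by rwa [div_le_iff₀ (by positivity)] at hn)
  have hlim : Tendsto (fun ε : ℝ => -(C * ε ^ (θ - 1) * Ω)) (𝓝[>] 0) (𝓝 0) := by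
    have h1 : ContinuousAt (fun ε : ℝ => -(C * ε ^ (θ - 1) * Ω)) 0 := by
      have := Real.continuousAt_rpow_const 0 (θ - 1) (Or.inr (by linarith))
      exact ((continuousAt_const.mul this).mul continuousAt_const).neg
    have h2 := h1.tendsto
    rw [Real.zero_rpow (by linarith)] at h2
    simp only [mul_zero, zero_mul, neg_zero] at h2
    exact h2.mono_left nhdsWithin_le_nhds
  have h0 : 0 ≤ g b - g a :=
    le_of_tendsto hlim (eventually_nhdsWithin_of_forall fun ε hε => key ε hε)
  linarith

end Control

/-! ### From local to global on an interval -/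

/-- A continuous function that is, off a countable set, nondecreasing to the right of every point
is nondecreasing. -/
theorem le_of_eventually_ge_right_off_countable {g : ℝ → ℝ} {a b : ℝ} (hab : a ≤ b)
    (hg : ContinuousOn g (Icc a b)) {K : Set ℝ} (hK : K.Countable)
    (h : ∀ u ∈ Ico a b, u ∉ K → ∃ c > u, ∀ w ∈ Ioo u c, w ≤ b → g u ≤ g w) : g a ≤ g b := by
  by_contra! hlt
  -- A nonempty open interval is uncountable, so some level `c` is missed by `g` on `K`. The last
  -- time at level at least `c` then lies outside `K`, and `g` drops below `c` immediately after it.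
  obtain ⟨c, hc, hcK⟩ : ∃ c ∈ Ioo (g b) (g a), c ∉ g '' K := by
    by_contra! hcon
    have : (Ioo (g b) (g a)).Countable := (hK.image g).mono hcon
    have h2 := Cardinal.Real.Ioo_countable_iff.1 this
    linarith
  set S := Icc a b ∩ g ⁻¹' Ici c with hS
  have hSc : IsClosed S := hg.preimage_isClosed_of_isClosed isClosed_Icc isClosed_Ici
  have hSne : S.Nonempty := ⟨a, left_mem_Icc.2 hab, hc.2.le⟩
  have hSb : BddAbove S := ⟨b, fun x hx => hx.1.2⟩
  set u := sSup S with hu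
  have huS : u ∈ S := hSc.csSup_mem hSne hSb
  have hub : u < b := lt_of_le_of_ne huS.1.2 (by
    intro h'; have := huS.2; rw [h'] at this; exact absurd this (not_le.2 hc.1))
  have hright : ∀ w ∈ Ioc u b, g w < c := by
    intro w hw
    by_contra! hcw
    exact absurd (le_csSup hSb (show w ∈ S from ⟨⟨huS.1.1.trans hw.1.le, hw.2⟩, hcw⟩))
      (not_le.2 hw.1)
  have hle : g u ≤ c := by
    have h1 : Tendsto g (𝓝[Ioc u b] u) (𝓝 (g u)) :=
      (hg u huS.1).mono_left (nhdsWithin_mono _ fun x hx => ⟨huS.1.1.trans hx.1.le, hx.2⟩)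
    have : (𝓝[Ioc u b] u).NeBot := by
      rw [nhdsWithin_Ioc_eq_nhdsGT hub]; infer_instance
    exact le_of_tendsto h1 (eventually_nhdsWithin_of_forall fun w hw => (hright w hw).le)
  have heq : g u = c := le_antisymm hle huS.2
  obtain ⟨e, he, H⟩ := h u ⟨huS.1.1, hub⟩ (fun hk => hcK ⟨u, hk, heq⟩)
  obtain ⟨w, hw⟩ := exists_between (lt_min he hub)
  have h1 := H w ⟨hw.1, hw.2.trans_le (min_le_left _ _)⟩ (hw.2.le.trans (min_le_right _ _))
  have h2 := hright w ⟨hw.1, hw.2.le.trans (min_le_right _ _)⟩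
  linarith

/-- A property of intervals that is stable under concatenation and holds for short intervals
holds for all intervals. -/
theorem interval_concat_induction {T δ : ℝ} (hδ : 0 < δ) {Q : ℝ → ℝ → Prop}
    (hsmall : ∀ s ∈ Icc 0 T, ∀ t ∈ Icc 0 T, s ≤ t → t - s < δ → Q s t)
    (hcat : ∀ s ∈ Icc 0 T, ∀ u ∈ Icc 0 T, ∀ t ∈ Icc 0 T, s ≤ u → u ≤ t → Q s u → Q u t → Q s t) :
    ∀ s ∈ Icc 0 T, ∀ t ∈ Icc 0 T, s ≤ t → Q s t := by
  have step : ∀ n : ℕ, ∀ s ∈ Icc 0 T, ∀ t ∈ Icc 0 T, s ≤ t → t - s ≤ n * (δ / 2) → Q s t := by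
    intro n
    induction n with
    | zero => exact fun s hs t ht hst h => hsmall s hs t ht hst (by simp at h; linarith)
    | succ n ih =>
      intro s hs t ht hst h
      push_cast at h
      by_cases h' : t - s < δ
      · exact hsmall s hs t ht hst h'
      · have hu : t - δ / 2 ∈ Icc 0 T := ⟨by linarith [hs.1], by linarith [ht.2]⟩
        exact hcat s hs _ hu t ht (by linarith) (by linarith)
          (ih s hs _ hu (by linarith) (by linarith))
          (hsmall _ hu t ht (by linarith) (by linarith))
  intro s hs t ht hst
  obtain ⟨n, hn⟩ := exists_nat_ge ((t - s) / (δ / 2))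
  exact step n s hs t ht hst (by rwa [div_le_iff₀ (by positivity)] at hn)

/-! ### Approximate flows -/

/-- A family of maps `μ s t : ℝ → ℝ`, `s ≤ t`, which is a flow up to an error of order `θ` in the
control `ω`, in the sense of Lipschitz maps. Only pairs with `ω s t ≤ R` matter. -/
structure IsApproxFlow (I : Set ℝ) (ω : ℝ → ℝ → ℝ) (γ θ K R : ℝ) (μ : ℝ → ℝ → ℝ → ℝ) :
    Prop where
  near_id : ∀ s ∈ I, ∀ t ∈ I, s ≤ t → ω s t ≤ R → ∀ x, |μ s t x - x| ≤ K * ω s t ^ γ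
  second_diff : ∀ s ∈ I, ∀ t ∈ I, s ≤ t → ω s t ≤ R → ∀ a b c d,
    |(μ s t a - a) - (μ s t b - b) - (μ s t c - c) + (μ s t d - d)| ≤
      K * ω s t ^ γ * (|a - b - c + d| + |c - d| * (|a - c| + |b - d|))
  defect : ∀ s ∈ I, ∀ u ∈ I, ∀ t ∈ I, s ≤ u → u ≤ t → ω s t ≤ R → ∀ x,
    |μ u t (μ s u x) - μ s t x| ≤ K * ω s t ^ θ
  defect_lipschitz : ∀ s ∈ I, ∀ u ∈ I, ∀ t ∈ I, s ≤ u → u ≤ t → ω s t ≤ R → ∀ x y,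
    |(μ u t (μ s u x) - μ s t x) - (μ u t (μ s u y) - μ s t y)| ≤ K * ω s t ^ θ * |x - y|

/-- The composition of the maps `μ` along `t i, t (i + 1), …, t (i + n)`. -/
def chain (μ : ℝ → ℝ → ℝ → ℝ) (t : ℕ → ℝ) (i : ℕ) : ℕ → ℝ → ℝ
  | 0 => id
  | n + 1 => μ (t (i + n)) (t (i + n + 1)) ∘ chain μ t i n

theorem chain_add (μ : ℝ → ℝ → ℝ → ℝ) (t : ℕ → ℝ) (i n k : ℕ) (x : ℝ) :
    chain μ t i (n + k) x = chain μ t (i + n) k (chain μ t i n x) := by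
  induction k with
  | zero => rfl
  | succ k ih =>
    rw [← Nat.add_assoc, chain, chain, Function.comp_apply, Function.comp_apply, ih]
    simp only [Nat.add_assoc]

/-- The constants of the nonlinear sewing lemma. -/
theorem exists_sewing_constants {γ θ K R : ℝ} (hγ : 0 < γ) (hθ : 1 < θ) (hK : 0 ≤ K)
    (hR : 0 < R) : ∃ ε > 0, ε ≤ R ∧ ε ≤ 1 ∧ ∃ L ≥ 0,
      L * (1 / 2) ^ θ + (1 + K * ε ^ γ) ^ 2 * (L * (1 / 2) ^ θ) + 2 * K ≤ L ∧
      L * (1 / 2) ^ θ * ((1 + K * ε ^ γ) * ((1 + K * ε ^ γ) + L * (1 / 2) ^ θ * ε ^ θ) +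
        (1 + K * ε ^ γ) ^ 2) + 2 * (K * ε ^ γ) * (1 + K * ε ^ γ) ^ 2 * (L * (1 / 2) ^ θ) *
          (1 + (1 + K * ε ^ γ)) + K * (1 + K * ε ^ γ) + K ≤ L := by
  set l : ℝ := (1 / 2) ^ θ with hl
  have hl0 : 0 < l := by positivity
  have hl1 : l < 1 / 2 := by
    have := Real.rpow_lt_rpow_of_exponent_gt (x := 1 / 2) (by norm_num) (by norm_num) hθ
    rwa [Real.rpow_one] at this
  -- At `ε = 0` both left-hand sides equal `2 * (L * l) + 2 * K`, which this choice makes `L - 1`;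
  -- it is possible because `θ > 1` gives `2 * l < 1`. Continuity in `ε` then leaves room for a
  -- small positive `ε`.
  set L := (2 * K + 1) / (1 - 2 * l) with hL
  have hden : 0 < 1 - 2 * l := by linarith
  have hL0 : 0 ≤ L := by positivity
  have hLeq : 2 * (L * l) + 2 * K = L - 1 := by
    rw [hL]; field_simp; ring
  have hcγ : ContinuousAt (fun ε : ℝ => K * ε ^ γ) 0 :=
    continuousAt_const.mul (Real.continuousAt_rpow_const 0 γ (Or.inr hγ.le))
  have hcθ : ContinuousAt (fun ε : ℝ => ε ^ θ) 0 :=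
    Real.continuousAt_rpow_const 0 θ (Or.inr (by linarith))
  have e1 : ∀ᶠ ε : ℝ in 𝓝 0, L * l + (1 + K * ε ^ γ) ^ 2 * (L * l) + 2 * K < L := by
    have : ContinuousAt (fun ε : ℝ => L * l + (1 + K * ε ^ γ) ^ 2 * (L * l) + 2 * K) 0 := by
      fun_prop (disch := assumption)
    refine this.eventually_lt_const ?_
    beta_reduce
    rw [Real.zero_rpow hγ.ne']
    linarith
  have e2 : ∀ᶠ ε : ℝ in 𝓝 0, L * l * ((1 + K * ε ^ γ) * ((1 + K * ε ^ γ) + L * l * ε ^ θ) +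
        (1 + K * ε ^ γ) ^ 2) + 2 * (K * ε ^ γ) * (1 + K * ε ^ γ) ^ 2 * (L * l) *
          (1 + (1 + K * ε ^ γ)) + K * (1 + K * ε ^ γ) + K < L := by
    have : ContinuousAt (fun ε : ℝ =>
        L * l * ((1 + K * ε ^ γ) * ((1 + K * ε ^ γ) + L * l * ε ^ θ) +
        (1 + K * ε ^ γ) ^ 2) + 2 * (K * ε ^ γ) * (1 + K * ε ^ γ) ^ 2 * (L * l) *
          (1 + (1 + K * ε ^ γ)) + K * (1 + K * ε ^ γ) + K) 0 := by
      fun_prop (disch := assumption)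
    refine this.eventually_lt_const ?_
    beta_reduce
    rw [Real.zero_rpow hγ.ne', Real.zero_rpow (by linarith)]
    nlinarith
  obtain ⟨ε, hε⟩ := ((((e1.and e2).filter_mono nhdsWithin_le_nhds).and
    (Ioc_mem_nhdsGT (lt_min hR one_pos))).exists (f := 𝓝[>] (0 : ℝ)))
  exact ⟨ε, hε.2.1, hε.2.2.trans (min_le_left _ _), hε.2.2.trans (min_le_right _ _), L, hL0,
    hε.1.1.le, hε.1.2.le⟩

namespace IsApproxFlow

variable {I : Set ℝ} {ω : ℝ → ℝ → ℝ} {γ θ K R : ℝ} {μ : ℝ → ℝ → ℝ → ℝ}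

theorem self_eq (h : IsApproxFlow I ω γ θ K R μ) (hω : IsControl I ω) (hγ : 0 < γ) (hR : 0 < R)
    {s : ℝ} (hs : s ∈ I) (x : ℝ) : μ s s x = x := by
  have := h.near_id s hs s hs le_rfl (by rw [hω.self_eq_zero hs]; exact hR.le) x
  rw [hω.self_eq_zero hs, Real.zero_rpow hγ.ne', mul_zero] at this
  exact sub_eq_zero.1 (abs_nonpos_iff.1 this)

theorem near_id_lipschitz (h : IsApproxFlow I ω γ θ K R μ) {s t : ℝ} (hs : s ∈ I) (ht : t ∈ I)
    (hst : s ≤ t) (hR : ω s t ≤ R) (x y : ℝ) :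
    |(μ s t x - x) - (μ s t y - y)| ≤ K * ω s t ^ γ * |x - y| := by
  have := h.second_diff s hs t ht hst hR x y y y
  simpa using this

theorem lipschitz (h : IsApproxFlow I ω γ θ K R μ) {s t : ℝ} (hs : s ∈ I) (ht : t ∈ I)
    (hst : s ≤ t) (hR : ω s t ≤ R) (x y : ℝ) :
    |μ s t x - μ s t y| ≤ (1 + K * ω s t ^ γ) * |x - y| := by
  have h1 := h.near_id_lipschitz hs ht hst hR x y
  have h2 := abs_add_le ((μ s t x - x) - (μ s t y - y)) (x - y)
  rw [show (μ s t x - x) - (μ s t y - y) + (x - y) = μ s t x - μ s t y by ring] at h2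
  linarith

/-- Needed when two trajectories are each compared with an approximation: the maps are then
evaluated at four points, and a Lipschitz bound alone would not give a factor proportional to the
distance of the starting points. -/
theorem second_diff' (h : IsApproxFlow I ω γ θ K R μ) {s t : ℝ} (hs : s ∈ I) (ht : t ∈ I)
    (hst : s ≤ t) (hR : ω s t ≤ R) (a b c d : ℝ) :
    |μ s t a - μ s t b - μ s t c + μ s t d| ≤ (1 + K * ω s t ^ γ) * |a - b - c + d| +
      K * ω s t ^ γ * (|c - d| * (|a - c| + |b - d|)) := by
  have h1 := h.second_diff s hs t ht hst hR a b c d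
  have h2 := abs_add_le ((μ s t a - a) - (μ s t b - b) - (μ s t c - c) + (μ s t d - d))
    (a - b - c + d)
  rw [show (μ s t a - a) - (μ s t b - b) - (μ s t c - c) + (μ s t d - d) + (a - b - c + d)
    = μ s t a - μ s t b - μ s t c + μ s t d by ring] at h2
  linarith

end IsApproxFlow

/-- A superadditive quantity along finitely many points can be split at an interval such that both
remaining parts carry at most half of the mass. -/
theorem exists_balanced_split {W : ℕ → ℕ → ℝ} {i n : ℕ} (hn : 0 < n)
    (hnn : ∀ j k, i ≤ j → j ≤ k → 0 ≤ W j k) (hself : ∀ j, i ≤ j → W j j = 0)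
    (hadd : ∀ j k l, i ≤ j → j ≤ k → k ≤ l → W j k + W k l ≤ W j l) :
    ∃ k l, n = k + (1 + l) ∧ W i (i + k) ≤ W i (i + n) / 2 ∧
      W (i + k + 1) (i + n) ≤ W i (i + n) / 2 := by
  classical
  have h0 := hnn i (i + n) le_rfl (by omega)
  -- If no proper prefix carries more than half of the mass, the last interval is taken as the
  -- middle one and the tail is empty. Otherwise the middle interval ends at the first prefix
  -- exceeding one half; superadditivity leaves at most half for the tail.
  by_cases hall : ∀ k < n, W i (i + k) ≤ W i (i + n) / 2
  · refine ⟨n - 1, 0, by omega, hall _ (by omega), ?_⟩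
    rw [show i + (n - 1) + 1 = i + n by omega, hself _ (by omega)]
    linarith
  · push Not at hall
    set k := Nat.find hall with hk
    obtain ⟨hkn, hkW⟩ := Nat.find_spec hall
    have hk0 : k ≠ 0 := by
      intro h
      rw [← hk, h, Nat.add_zero, hself i le_rfl] at hkW
      linarith
    refine ⟨k - 1, n - k, by omega, ?_, ?_⟩
    · by_contra! hcon
      exact Nat.find_min hall (m := k - 1) (by omega) ⟨by omega, hcon⟩
    · rw [show i + (k - 1) + 1 = i + k by omega]
      have := hadd i (i + k) (i + n) le_rfl (by omega) (by omega)
      rw [← hk] at hkW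
      linarith

/-! ### Compositions of an approximate flow along a partition -/

section Chain

variable {I : Set ℝ} {ω : ℝ → ℝ → ℝ} {γ θ K R ε L : ℝ} {μ : ℝ → ℝ → ℝ → ℝ} {t : ℕ → ℝ}

/-- Strong induction on the number of intervals, with a constant independent of it. A balanced split
leaves outer blocks carrying at most half of the control, so their errors come with the factor
`(1/2) ^ θ < 1/2`. The middle interval is a single map, and replacing the three composed maps by one
costs two defects; the condition `hc` says that the total is again at most `L`. -/
theorem abs_chain_sub_le (h : IsApproxFlow I ω γ θ K R μ) (hω : IsControl I ω) (hγ : 0 < γ)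
    (hθ : 1 < θ) (hK : 0 ≤ K) (hε : 0 < ε) (hεR : ε ≤ R) (hL : 0 ≤ L)
    (hc : L * (1 / 2) ^ θ + (1 + K * ε ^ γ) ^ 2 * (L * (1 / 2) ^ θ) + 2 * K ≤ L)
    (ht : Monotone t) (htI : ∀ i, t i ∈ I) (n : ℕ) : ∀ i, ω (t i) (t (i + n)) ≤ ε → ∀ x,
      |chain μ t i n x - μ (t i) (t (i + n)) x| ≤ L * ω (t i) (t (i + n)) ^ θ := by
  induction n using Nat.strong_induction_on with
  | _ n ih =>
  intro i hW x
  rcases Nat.eq_zero_or_pos n with rfl | hn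
  · rw [Nat.add_zero, h.self_eq hω hγ (hε.trans_le hεR) (htI i), chain, id, sub_self, abs_zero]
    rw [hω.self_eq_zero (htI i), Real.zero_rpow (by linarith), mul_zero]
  obtain ⟨k, l, rfl, h1, h2⟩ := exists_balanced_split (W := fun j k => ω (t j) (t k)) (i := i) hn
    (fun j k _ hjk => hω.nonneg _ (htI j) _ (htI k) (ht hjk))
    (fun j _ => hω.self_eq_zero (htI j))
    (fun j k l _ hjk hkl => hω.superadd _ (htI j) _ (htI k) _ (htI l) (ht hjk) (ht hkl))
  simp only [show i + (k + (1 + l)) = i + k + 1 + l by omega] at *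
  rw [chain_add, chain_add]
  set a := t i
  set b := t (i + k)
  set c := t (i + k + 1)
  set d := t (i + k + 1 + l)
  have ha : a ∈ I := htI _
  have hb : b ∈ I := htI _
  have hcI : c ∈ I := htI _
  have hd : d ∈ I := htI _
  have hab : a ≤ b := ht (by omega)
  have hbc : b ≤ c := ht (by omega)
  have hcd : c ≤ d := ht (by omega)
  set w := ω a d with hw
  have hw0 : 0 ≤ w := hω.nonneg _ ha _ hd (hab.trans (hbc.trans hcd))
  have hbd : ω b d ≤ w := hω.mono_left ha hb hd hab (hbc.trans hcd)
  have hbc' : ω b c ≤ w := (hω.mono_right hb hcI hd hbc hcd).trans hbd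
  have hcd' : ω c d ≤ w := (hω.mono_left hb hcI hd hbc hcd).trans hbd
  have hab' : ω a b ≤ w := hω.mono_right ha hb hd hab (hbc.trans hcd)
  have hhalf : ∀ r, 0 ≤ r → r ≤ w / 2 → L * r ^ θ ≤ L * (1 / 2) ^ θ * w ^ θ := by
    intro r hr0 hr
    rw [mul_assoc, ← Real.mul_rpow (by norm_num) hw0]
    gcongr
    linarith
  have hpow : ∀ r, 0 ≤ r → r ≤ w → K * r ^ θ ≤ K * w ^ θ := by
    intro r hr0 hr
    gcongr
  have hlip : ∀ r, 0 ≤ r → r ≤ w → 1 + K * r ^ γ ≤ 1 + K * ε ^ γ := by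
    intro r hr0 hr
    have := hr.trans hW
    gcongr
  have hq : 0 ≤ 1 + K * ε ^ γ := by positivity
  set l' := L * (1 / 2) ^ θ with hl'
  have hl0 : 0 ≤ l' := by positivity
  have hone : chain μ t (i + k) 1 = μ b c := by
    funext z; rfl
  rw [hone]
  set x1 := chain μ t i k x
  set x1' := μ a b x
  have e1 : |x1 - x1'| ≤ l' * w ^ θ :=
    (ih k (by omega) i (hab'.trans hW) x).trans (hhalf _ (hω.nonneg _ ha _ hb hab) h1)
  have e2 : |chain μ t (i + k + 1) l (μ b c x1) - μ c d (μ b c x1)| ≤ l' * w ^ θ :=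
    (ih l (by omega) (i + k + 1) (hcd'.trans hW) _).trans
      (hhalf _ (hω.nonneg _ hcI _ hd hcd) h2)
  have e3 : |μ b c x1 - μ b c x1'| ≤ (1 + K * ε ^ γ) * (l' * w ^ θ) :=
    (h.lipschitz hb hcI hbc (hbc'.trans (hW.trans hεR)) _ _).trans
      (mul_le_mul (hlip _ (hω.nonneg _ hb _ hcI hbc) hbc') e1 (abs_nonneg _) hq)
  have e4 : |μ c d (μ b c x1) - μ c d (μ b c x1')| ≤
      (1 + K * ε ^ γ) * ((1 + K * ε ^ γ) * (l' * w ^ θ)) :=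
    (h.lipschitz hcI hd hcd (hcd'.trans (hW.trans hεR)) _ _).trans
      (mul_le_mul (hlip _ (hω.nonneg _ hcI _ hd hcd) hcd') e3 (abs_nonneg _) hq)
  have e5 : |μ c d (μ b c x1') - μ b d x1'| ≤ K * w ^ θ :=
    (h.defect b hb c hcI d hd hbc hcd (hbd.trans (hW.trans hεR)) _).trans
      (hpow _ (hω.nonneg _ hb _ hd (hbc.trans hcd)) hbd)
  have e6 : |μ b d x1' - μ a d x| ≤ K * w ^ θ :=
    h.defect a ha b hb d hd hab (hbc.trans hcd) (hW.trans hεR) x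
  have hfin := mul_le_mul_of_nonneg_right hc (Real.rpow_nonneg hw0 θ)
  rw [abs_le] at *
  constructor <;> nlinarith

/-- The same telescoping, applied to differences of two trajectories. The error of the first block
is propagated through the next two maps by the four-point estimate, whose quadratic part uses
`abs_chain_sub_le` for each trajectory separately. -/
theorem abs_chain_sub_sub_le (h : IsApproxFlow I ω γ θ K R μ) (hω : IsControl I ω) (hγ : 0 < γ)
    (hθ : 1 < θ) (hK : 0 ≤ K) (hε : 0 < ε) (hεR : ε ≤ R) (hL : 0 ≤ L)
    (hc : L * (1 / 2) ^ θ + (1 + K * ε ^ γ) ^ 2 * (L * (1 / 2) ^ θ) + 2 * K ≤ L)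
    (hc' : L * (1 / 2) ^ θ * ((1 + K * ε ^ γ) * ((1 + K * ε ^ γ) + L * (1 / 2) ^ θ * ε ^ θ) +
        (1 + K * ε ^ γ) ^ 2) + 2 * (K * ε ^ γ) * (1 + K * ε ^ γ) ^ 2 * (L * (1 / 2) ^ θ) *
          (1 + (1 + K * ε ^ γ)) + K * (1 + K * ε ^ γ) + K ≤ L)
    (ht : Monotone t) (htI : ∀ i, t i ∈ I) (n : ℕ) : ∀ i, ω (t i) (t (i + n)) ≤ ε → ∀ x y,
      |(chain μ t i n x - chain μ t i n y) - (μ (t i) (t (i + n)) x - μ (t i) (t (i + n)) y)| ≤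
        L * ω (t i) (t (i + n)) ^ θ * |x - y| := by
  induction n using Nat.strong_induction_on with
  | _ n ih =>
  intro i hW x y
  rcases Nat.eq_zero_or_pos n with rfl | hn
  · rw [Nat.add_zero, h.self_eq hω hγ (hε.trans_le hεR) (htI i),
      h.self_eq hω hγ (hε.trans_le hεR) (htI i), chain, id, id, sub_self, abs_zero]
    rw [hω.self_eq_zero (htI i), Real.zero_rpow (by linarith), mul_zero, zero_mul]
  obtain ⟨k, l, rfl, h1, h2⟩ := exists_balanced_split (W := fun j k => ω (t j) (t k)) (i := i) hn
    (fun j k _ hjk => hω.nonneg _ (htI j) _ (htI k) (ht hjk))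
    (fun j _ => hω.self_eq_zero (htI j))
    (fun j k l _ hjk hkl => hω.superadd _ (htI j) _ (htI k) _ (htI l) (ht hjk) (ht hkl))
  have hzero := fun i hi x => abs_chain_sub_le h hω hγ hθ hK hε hεR hL hc ht htI k i hi x
  simp only [show i + (k + (1 + l)) = i + k + 1 + l by omega] at *
  simp only [chain_add]
  have hzero := hzero i
  set a := t i
  set b := t (i + k)
  set c := t (i + k + 1)
  set d := t (i + k + 1 + l)
  have ha : a ∈ I := htI _
  have hb : b ∈ I := htI _
  have hcI : c ∈ I := htI _
  have hd : d ∈ I := htI _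
  have hab : a ≤ b := ht (by omega)
  have hbc : b ≤ c := ht (by omega)
  have hcd : c ≤ d := ht (by omega)
  set w := ω a d with hw
  have hw0 : 0 ≤ w := hω.nonneg _ ha _ hd (hab.trans (hbc.trans hcd))
  have hbd : ω b d ≤ w := hω.mono_left ha hb hd hab (hbc.trans hcd)
  have hbc' : ω b c ≤ w := (hω.mono_right hb hcI hd hbc hcd).trans hbd
  have hcd' : ω c d ≤ w := (hω.mono_left hb hcI hd hbc hcd).trans hbd
  have hab' : ω a b ≤ w := hω.mono_right ha hb hd hab (hbc.trans hcd)
  have hhalf : ∀ r, 0 ≤ r → r ≤ w / 2 → L * r ^ θ ≤ L * (1 / 2) ^ θ * w ^ θ := by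
    intro r hr0 hr
    rw [mul_assoc, ← Real.mul_rpow (by norm_num) hw0]
    gcongr
    linarith
  have hpow : ∀ r, 0 ≤ r → r ≤ w → K * r ^ θ ≤ K * w ^ θ := by
    intro r hr0 hr
    gcongr
  have hlip : ∀ r, 0 ≤ r → r ≤ w → K * r ^ γ ≤ K * ε ^ γ := by
    intro r hr0 hr
    have := hr.trans hW
    gcongr
  set κ := K * ε ^ γ with hκ
  have hκ0 : 0 ≤ κ := by positivity
  set q := 1 + κ with hq
  have hq0 : 0 ≤ q := by positivity
  set l' := L * (1 / 2) ^ θ with hl'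
  have hl0 : 0 ≤ l' := by positivity
  set A := w ^ θ with hA
  have hA0 : 0 ≤ A := Real.rpow_nonneg hw0 θ
  have hAε : A ≤ ε ^ θ := Real.rpow_le_rpow hw0 hW (by linarith)
  have hone : chain μ t (i + k) 1 = μ b c := by
    funext z; rfl
  rw [hone]
  set E := |x - y| with hE
  have hE0 : 0 ≤ E := abs_nonneg _
  have hbcR := hbc'.trans (hW.trans hεR)
  have hcdR := hcd'.trans (hW.trans hεR)
  have habR := hab'.trans (hW.trans hεR)
  have kbc := hlip _ (hω.nonneg _ hb _ hcI hbc) hbc'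
  have kcd := hlip _ (hω.nonneg _ hcI _ hd hcd) hcd'
  have kab := hlip _ (hω.nonneg _ ha _ hb hab) hab'
  set x1 := chain μ t i k x
  set y1 := chain μ t i k y
  set x1' := μ a b x
  set y1' := μ a b y
  -- first block
  have e1 : |x1 - x1'| ≤ l' * A :=
    (hzero (hab'.trans hW) x).trans (hhalf _ (hω.nonneg _ ha _ hb hab) h1)
  have e1y : |y1 - y1'| ≤ l' * A :=
    (hzero (hab'.trans hW) y).trans (hhalf _ (hω.nonneg _ ha _ hb hab) h1)
  have e1d : |x1 - y1 - (x1' - y1')| ≤ l' * A * E :=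
    (ih k (by omega) i (hab'.trans hW) x y).trans
      (mul_le_mul_of_nonneg_right (hhalf _ (hω.nonneg _ ha _ hb hab) h1) hE0)
  have e1e : |x1' - y1'| ≤ q * E :=
    (h.lipschitz ha hb hab habR _ _).trans (mul_le_mul_of_nonneg_right (by linarith) hE0)
  have e1f : |x1 - y1| ≤ (q + l' * A) * E := by
    have := abs_add_le (x1 - y1 - (x1' - y1')) (x1' - y1')
    rw [sub_add_cancel] at this
    linarith
  -- the middle map
  have hqbc : 1 + K * ω b c ^ γ ≤ q := by linarith
  have hqcd : 1 + K * ω c d ^ γ ≤ q := by linarith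
  have e2 : |μ b c x1 - μ b c x1'| ≤ q * (l' * A) :=
    (h.lipschitz hb hcI hbc hbcR _ _).trans (mul_le_mul hqbc e1 (abs_nonneg _) hq0)
  have e2y : |μ b c y1 - μ b c y1'| ≤ q * (l' * A) :=
    (h.lipschitz hb hcI hbc hbcR _ _).trans (mul_le_mul hqbc e1y (abs_nonneg _) hq0)
  have e2e : |μ b c x1' - μ b c y1'| ≤ q * (q * E) :=
    (h.lipschitz hb hcI hbc hbcR _ _).trans (mul_le_mul hqbc e1e (abs_nonneg _) hq0)
  have e2f : |μ b c x1 - μ b c y1| ≤ q * ((q + l' * A) * E) :=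
    (h.lipschitz hb hcI hbc hbcR _ _).trans (mul_le_mul hqbc e1f (abs_nonneg _) hq0)
  have e2d : |μ b c x1 - μ b c y1 - μ b c x1' + μ b c y1'| ≤
      q * (l' * A * E) + κ * (q * E * (l' * A + l' * A)) := by
    refine (h.second_diff' hb hcI hbc hbcR _ _ _ _).trans (add_le_add ?_ ?_)
    · refine mul_le_mul hqbc ?_ (abs_nonneg _) hq0
      rwa [show x1 - y1 - x1' + y1' = x1 - y1 - (x1' - y1') by ring]
    · exact mul_le_mul kbc (mul_le_mul e1e (add_le_add e1 e1y) (by positivity) (by positivity))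
        (by positivity) hκ0
  -- the last block
  have e3d : |μ c d (μ b c x1) - μ c d (μ b c y1) - μ c d (μ b c x1') + μ c d (μ b c y1')| ≤
      q * (q * (l' * A * E) + κ * (q * E * (l' * A + l' * A))) +
        κ * (q * (q * E) * (q * (l' * A) + q * (l' * A))) := by
    refine (h.second_diff' hcI hd hcd hcdR _ _ _ _).trans (add_le_add ?_ ?_)
    · exact mul_le_mul hqcd e2d (abs_nonneg _) hq0
    · exact mul_le_mul kcd (mul_le_mul e2e (add_le_add e2 e2y) (by positivity) (by positivity))
        (by positivity) hκ0
  have e4 : |(chain μ t (i + k + 1) l (μ b c x1) - chain μ t (i + k + 1) l (μ b c y1)) -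
      (μ c d (μ b c x1) - μ c d (μ b c y1))| ≤ l' * A * (q * ((q + l' * A) * E)) :=
    (ih l (by omega) (i + k + 1) (hcd'.trans hW) _ _).trans
      (mul_le_mul (hhalf _ (hω.nonneg _ hcI _ hd hcd) h2) e2f (abs_nonneg _) (by positivity))
  have e5 : |(μ c d (μ b c x1') - μ b d x1') - (μ c d (μ b c y1') - μ b d y1')| ≤
      K * A * (q * E) :=
    (h.defect_lipschitz b hb c hcI d hd hbc hcd (hbd.trans (hW.trans hεR)) _ _).trans
      (mul_le_mul (hpow _ (hω.nonneg _ hb _ hd (hbc.trans hcd)) hbd) e1e (abs_nonneg _)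
        (by positivity))
  have e6 : |(μ b d x1' - μ a d x) - (μ b d y1' - μ a d y)| ≤ K * A * E :=
    h.defect_lipschitz a ha b hb d hd hab (hbc.trans hcd) (hW.trans hεR) x y
  -- The product of two block errors is quadratic in `A`. One factor is replaced by `ε ^ θ`, so that
  -- the final inequality is `hc'` multiplied by `A * E`.
  have e4' : l' * A * (q * ((q + l' * A) * E)) ≤ l' * A * (q * ((q + l' * ε ^ θ) * E)) := by
    gcongr
  have hfin := mul_le_mul_of_nonneg_right hc' (mul_nonneg hA0 hE0)
  have htot : l' * A * (q * ((q + l' * ε ^ θ) * E)) +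
      (q * (q * (l' * A * E) + κ * (q * E * (l' * A + l' * A))) +
        κ * (q * (q * E) * (q * (l' * A) + q * (l' * A)))) + K * A * (q * E) + K * A * E ≤
      L * A * E := by
    refine le_trans (le_of_eq ?_) (hfin.trans (le_of_eq (by ring)))
    ring
  rw [abs_le] at e3d e4 e5 e6 ⊢
  constructor <;> linarith [e3d.1, e3d.2, e4.1, e4.2, e5.1, e5.2, e6.1, e6.2]

end Chain

/-! ### The nonlinear sewing lemma -/

/-- The elements of a finite set, enumerated in increasing order. -/
theorem exists_monotone_enumeration {α : Type*} [LinearOrder α] (P : Finset α)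
    (hP : P.Nonempty) : ∃ (t : ℕ → α) (idx : α → ℕ), Monotone t ∧ (∀ s ∈ P, t (idx s) = s) ∧
      ∀ s ∈ P, ∀ u ∈ P, s ≤ u → idx s ≤ idx u := by
  classical
  have hcard : 0 < P.card := hP.card_pos
  let e := P.orderIsoOfFin rfl
  -- Beyond the last index the enumeration stays at the greatest element, which keeps it monotone on
  -- all of `ℕ`.
  let clamp : ℕ → Fin P.card := fun i => ⟨min i (P.card - 1), by omega⟩
  refine ⟨fun i => (e (clamp i) : α), fun s => if hs : s ∈ P then (e.symm ⟨s, hs⟩ : ℕ) else 0,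
    ?_, ?_, ?_⟩
  · intro i j hij
    have : clamp i ≤ clamp j := by
      simp only [clamp, Fin.mk_le_mk]; omega
    exact e.monotone this
  · intro s hs
    have h1 : clamp (e.symm ⟨s, hs⟩ : ℕ) = e.symm ⟨s, hs⟩ := by
      have := (e.symm ⟨s, hs⟩).2
      ext; simp only [clamp]; omega
    simp only [dif_pos hs, h1, OrderIso.apply_symm_apply]
  · intro s hs u hu hsu
    simp only [dif_pos hs, dif_pos hu]
    exact e.symm.monotone (show (⟨s, hs⟩ : P) ≤ ⟨u, hu⟩ from hsu)

/-- The exact flow along a finite set of times generated by an approximate flow. -/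
theorem IsApproxFlow.exists_discrete_flow {I : Set ℝ} {ω : ℝ → ℝ → ℝ} {γ θ K R : ℝ}
    {μ : ℝ → ℝ → ℝ → ℝ} (h : IsApproxFlow I ω γ θ K R μ)
    (hω : IsControl I ω) (hγ : 0 < γ) (hθ : 1 < θ) (hK : 0 ≤ K) (hR : 0 < R) :
    ∃ ε > 0, ε ≤ R ∧ ε ≤ 1 ∧ ∃ L ≥ 0, ∀ P : Finset I, ∃ ψ : ℝ → ℝ → ℝ → ℝ,
      (∀ s ∈ P, ∀ u ∈ P, ∀ t ∈ P, s ≤ u → u ≤ t → ∀ x, ψ u t (ψ s u x) = ψ s t x) ∧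
      (∀ s ∈ P, ∀ t ∈ P, s ≤ t → ω s t ≤ ε → ∀ x, |ψ s t x - μ s t x| ≤ L * ω s t ^ θ) ∧
      (∀ s ∈ P, ∀ t ∈ P, s ≤ t → ω s t ≤ ε → ∀ x y,
        |(ψ s t x - ψ s t y) - (μ s t x - μ s t y)| ≤ L * ω s t ^ θ * |x - y|) := by
  obtain ⟨ε, hε, hεR, hε1, L, hL, hc, hc'⟩ := exists_sewing_constants hγ hθ hK hR
  refine ⟨ε, hε, hεR, hε1, L, hL, fun P => ?_⟩
  rcases P.eq_empty_or_nonempty with rfl | hP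
  · exact ⟨μ, by simp, by simp, by simp⟩
  obtain ⟨t, idx, ht, hidx, hmono⟩ := exists_monotone_enumeration P hP
  set τ : ℕ → ℝ := fun i => (t i : ℝ) with hτ
  have hτm : Monotone τ := fun i j hij => ht hij
  have hτI : ∀ i, τ i ∈ I := fun i => (t i).2
  classical
  let ι : ℝ → ℕ := fun s => if hs : s ∈ I then idx ⟨s, hs⟩ else 0
  have hι : ∀ s : I, ι s = idx s := fun s => by simp [ι]
  have hτι : ∀ s ∈ P, τ (idx s) = s := fun s hs => by simp [hτ, hidx s hs]
  -- For `s ≤ u` in `P` the truncated subtraction is exact, and the default value of `ι` outside `I`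
  -- is never used. The constants `ε` and `L` do not depend on `P`.
  refine ⟨fun s u => chain μ τ (ι s) (ι u - ι s), ?_, ?_, ?_⟩
  · intro s hs u hu v hv hsu huv x
    simp only [hι]
    have h1 := hmono s hs u hu hsu
    have h2 := hmono u hu v hv huv
    have := chain_add μ τ (idx s) (idx u - idx s) (idx v - idx u) x
    rw [show idx s + (idx u - idx s) = idx u by omega,
      show idx u - idx s + (idx v - idx u) = idx v - idx s by omega] at this
    exact this.symm
  · intro s hs u hu hsu hW x
    simp only [hι]
    have h1 := hmono s hs u hu hsu
    have := abs_chain_sub_le h hω hγ hθ hK hε hεR hL hc hτm hτI (idx u - idx s) (idx s)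
    rw [show idx s + (idx u - idx s) = idx u by omega, hτι s hs, hτι u hu] at this
    exact this hW x
  · intro s hs u hu hsu hW x y
    simp only [hι]
    have h1 := hmono s hs u hu hsu
    have := abs_chain_sub_sub_le h hω hγ hθ hK hε hεR hL hc hc' hτm hτI (idx u - idx s) (idx s)
    rw [show idx s + (idx u - idx s) = idx u by omega, hτι s hs, hτι u hu] at this
    exact this hW x y

/-- **Nonlinear sewing lemma**: an approximate flow is close to an exact flow. -/
theorem IsApproxFlow.exists_flow {T : ℝ} {ω : ℝ → ℝ → ℝ} {γ θ K R : ℝ}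
    {μ : ℝ → ℝ → ℝ → ℝ} (h : IsApproxFlow (Icc 0 T) ω γ θ K R μ)
    (hω : IsControl (Icc 0 T) ω) (hr : IsRegular (Icc 0 T) ω)
    (hγ : 0 < γ) (hθ : 1 < θ) (hK : 0 ≤ K) (hR : 0 < R) :
    ∃ φ : ℝ → ℝ → ℝ → ℝ, ∃ ε > 0, ε ≤ R ∧ ε ≤ 1 ∧ ∃ L ≥ 0,
      (∀ s ∈ Icc 0 T, ∀ u ∈ Icc 0 T, ∀ t ∈ Icc 0 T, s ≤ u → u ≤ t → ∀ x,
        φ u t (φ s u x) = φ s t x) ∧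
      (∀ s ∈ Icc 0 T, ∀ t ∈ Icc 0 T, s ≤ t → ω s t ≤ ε → ∀ x,
        |φ s t x - μ s t x| ≤ L * ω s t ^ θ) ∧
      (∀ s ∈ Icc 0 T, ∀ t ∈ Icc 0 T, s ≤ t → ω s t ≤ ε → ∀ x y,
        |(φ s t x - φ s t y) - (μ s t x - μ s t y)| ≤ L * ω s t ^ θ * |x - y|) := by
  obtain ⟨ε, hε, hεR, hε1, L, hL, H⟩ := h.exists_discrete_flow hω hγ hθ hK hR
  choose ψ hflow hnear hlip using H
  -- An ultrafilter containing the tails of the finite subsets: each given time eventually belongs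
  -- to `P`, and every bounded family of reals converges. This replaces a diagonal extraction or a
  -- Cauchy argument over partitions.
  let U : Ultrafilter (Finset (Icc 0 T)) := Ultrafilter.of atTop
  have hU : (U : Filter (Finset (Icc 0 T))) ≤ atTop := Ultrafilter.of_le atTop
  have hmem : ∀ s : Icc (0 : ℝ) T, ∀ᶠ P in (U : Filter (Finset (Icc 0 T))), s ∈ P := by
    intro s
    have : ∀ᶠ P in (atTop : Filter (Finset (Icc 0 T))), s ∈ P := by
      filter_upwards [eventually_ge_atTop ({s} : Finset (Icc 0 T))] with P hP
      exact hP (Finset.mem_singleton_self s)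
    exact hU this
  obtain ⟨δ, hδ, hδε⟩ := hr.exists_le hε
  -- boundedness
  have hbdd : ∀ s ∈ Icc 0 T, ∀ t ∈ Icc 0 T, s ≤ t → ∃ C, ∀ᶠ P in (U : Filter (Finset (Icc 0 T))),
      ∀ x, |ψ P s t x - x| ≤ C := by
    refine interval_concat_induction hδ ?_ ?_
    · intro s hs t ht hst hd
      have hW := hδε s hs t ht hst hd
      refine ⟨L * ω s t ^ θ + K * ω s t ^ γ, ?_⟩
      filter_upwards [hmem ⟨s, hs⟩, hmem ⟨t, ht⟩] with P hsP htP x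
      have h1 := hnear P ⟨s, hs⟩ hsP ⟨t, ht⟩ htP hst hW x
      have h2 := h.near_id s hs t ht hst (hW.trans hεR) x
      exact (abs_sub_le _ _ _).trans (add_le_add h1 h2)
    · rintro s hs u hu t ht hsu hut ⟨C, hC⟩ ⟨C', hC'⟩
      refine ⟨C' + C, ?_⟩
      filter_upwards [hmem ⟨s, hs⟩, hmem ⟨u, hu⟩, hmem ⟨t, ht⟩, hC, hC'] with P hsP huP htP h1 h2 x
      rw [← hflow P ⟨s, hs⟩ hsP ⟨u, hu⟩ huP ⟨t, ht⟩ htP hsu hut x]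
      exact (abs_sub_le _ _ _).trans (add_le_add (h2 _) (h1 _))
  -- Lipschitz bounds
  have hLip : ∀ s ∈ Icc 0 T, ∀ t ∈ Icc 0 T, s ≤ t → ∃ C, 0 ≤ C ∧
      ∀ᶠ P in (U : Filter (Finset (Icc 0 T))), ∀ x y, |ψ P s t x - ψ P s t y| ≤ C * |x - y| := by
    refine interval_concat_induction hδ ?_ ?_
    · intro s hs t ht hst hd
      have hW := hδε s hs t ht hst hd
      have h0 := hω.nonneg s hs t ht hst
      refine ⟨L * ω s t ^ θ + (1 + K * ω s t ^ γ), by positivity, ?_⟩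
      filter_upwards [hmem ⟨s, hs⟩, hmem ⟨t, ht⟩] with P hsP htP x y
      have h1 := hlip P ⟨s, hs⟩ hsP ⟨t, ht⟩ htP hst hW x y
      have h2 := h.lipschitz hs ht hst (hW.trans hεR) x y
      have h3 := abs_add_le (ψ P s t x - ψ P s t y - (μ s t x - μ s t y)) (μ s t x - μ s t y)
      rw [sub_add_cancel] at h3
      dsimp only at h1
      linarith
    · rintro s hs u hu t ht hsu hut ⟨C, hC0, hC⟩ ⟨C', hC0', hC'⟩
      refine ⟨C' * C, by positivity, ?_⟩
      filter_upwards [hmem ⟨s, hs⟩, hmem ⟨u, hu⟩, hmem ⟨t, ht⟩, hC, hC']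
        with P hsP huP htP h1 h2 x y
      rw [← hflow P ⟨s, hs⟩ hsP ⟨u, hu⟩ huP ⟨t, ht⟩ htP hsu hut x,
        ← hflow P ⟨s, hs⟩ hsP ⟨u, hu⟩ huP ⟨t, ht⟩ htP hsu hut y, mul_assoc]
      exact (h2 _ _).trans (mul_le_mul_of_nonneg_left (h1 _ _) hC0')
  -- the limit
  have hlim : ∀ s t x, ∃ l, s ∈ Icc 0 T → t ∈ Icc 0 T → s ≤ t →
      Tendsto (fun P => ψ P s t x) U (𝓝 l) := by
    intro s t x
    by_cases hst : s ∈ Icc 0 T ∧ t ∈ Icc 0 T ∧ s ≤ t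
    · obtain ⟨C, hC⟩ := hbdd s hst.1 t hst.2.1 hst.2.2
      have hK : IsCompact (Icc (x - C) (x + C)) := isCompact_Icc
      obtain ⟨l, -, hl⟩ := hK.ultrafilter_le_nhds (U.map fun P => ψ P s t x) (by
        rw [le_principal_iff]
        change ∀ᶠ P in (U : Filter (Finset (Icc 0 T))), ψ P s t x ∈ Icc (x - C) (x + C)
        filter_upwards [hC] with P hP
        have := abs_le.1 (hP x)
        exact ⟨by linarith, by linarith⟩)
      exact ⟨l, fun _ _ _ => hl⟩
    · exact ⟨0, fun h1 h2 h3 => absurd ⟨h1, h2, h3⟩ hst⟩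
  choose φ hφ using hlim
  refine ⟨φ, ε, hε, hεR, hε1, L, hL, ?_, ?_, ?_⟩
  · intro s hs u hu t ht hsu hut x
    obtain ⟨C, hC0, hC⟩ := hLip u hu t ht hut
    have h1 : Tendsto (fun P => ψ P u t (φ s u x) - ψ P s t x) U
        (𝓝 (φ u t (φ s u x) - φ s t x)) :=
      (hφ u t (φ s u x) hu ht hut).sub (hφ s t x hs ht (hsu.trans hut))
    -- The inner point also varies with `P`. The Lipschitz bound, eventually uniform in `P`, allows
    -- it to be replaced by its limit.
    have h2 : Tendsto (fun P => C * |φ s u x - ψ P s u x|) U (𝓝 0) := by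
      have := ((tendsto_const_nhds (x := φ s u x)).sub (hφ s u x hs hu hsu)).abs.const_mul C
      simpa using this
    have h3 : Tendsto (fun P => ψ P u t (φ s u x) - ψ P s t x) U (𝓝 0) := by
      refine squeeze_zero_norm' ?_ h2
      filter_upwards [hmem ⟨s, hs⟩, hmem ⟨u, hu⟩, hmem ⟨t, ht⟩, hC] with P hsP huP htP hCP
      rw [← hflow P ⟨s, hs⟩ hsP ⟨u, hu⟩ huP ⟨t, ht⟩ htP hsu hut x]
      exact hCP _ _
    exact sub_eq_zero.1 (tendsto_nhds_unique h1 h3)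
  · intro s hs t ht hst hW x
    refine le_of_tendsto ((hφ s t x hs ht hst).sub_const (μ s t x)).abs ?_
    filter_upwards [hmem ⟨s, hs⟩, hmem ⟨t, ht⟩] with P hsP htP
    exact hnear P ⟨s, hs⟩ hsP ⟨t, ht⟩ htP hst hW x
  · intro s hs t ht hst hW x y
    refine le_of_tendsto (((hφ s t x hs ht hst).sub (hφ s t y hs ht hst)).sub_const
      (μ s t x - μ s t y)).abs ?_
    filter_upwards [hmem ⟨s, hs⟩, hmem ⟨t, ht⟩] with P hsP htP
    exact hlip P ⟨s, hs⟩ hsP ⟨t, ht⟩ htP hst hW x y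

/-! ### Global bi-Lipschitz flows -/

/-- A flow of bi-Lipschitz increasing maps of the line which follows the approximate flow `μ`
up to an error of order `θ`. -/
structure IsFlow (T : ℝ) (ω : ℝ → ℝ → ℝ) (γ θ C L ε : ℝ) (μ φ : ℝ → ℝ → ℝ → ℝ) : Prop where
  flow : ∀ s ∈ Icc 0 T, ∀ u ∈ Icc 0 T, ∀ t ∈ Icc 0 T, s ≤ u → u ≤ t → ∀ x,
    φ u t (φ s u x) = φ s t x
  bilipschitz : ∀ s ∈ Icc 0 T, ∀ t ∈ Icc 0 T, s ≤ t → ∀ x y, x ≤ y →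
    L⁻¹ * (y - x) ≤ φ s t y - φ s t x ∧ φ s t y - φ s t x ≤ L * (y - x)
  near_id : ∀ s ∈ Icc 0 T, ∀ t ∈ Icc 0 T, s ≤ t → ∀ x, |φ s t x - x| ≤ C * ω s t ^ γ
  near_id_lipschitz : ∀ s ∈ Icc 0 T, ∀ t ∈ Icc 0 T, s ≤ t → ω s t ≤ ε → ∀ x y,
    |(φ s t x - x) - (φ s t y - y)| ≤ C * ω s t ^ γ * |x - y|
  taylor : ∀ s ∈ Icc 0 T, ∀ t ∈ Icc 0 T, s ≤ t → ω s t ≤ ε → ∀ x,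
    |φ s t x - μ s t x| ≤ C * ω s t ^ θ

namespace IsFlow

variable {T : ℝ} {ω : ℝ → ℝ → ℝ} {γ θ C L ε : ℝ} {μ φ : ℝ → ℝ → ℝ → ℝ} {s t : ℝ}

theorem self_eq (h : IsFlow T ω γ θ C L ε μ φ) (hω : IsControl (Icc 0 T) ω) (hγ : 0 < γ)
    (hs : s ∈ Icc 0 T) (x : ℝ) : φ s s x = x := by
  have := h.near_id s hs s hs le_rfl x
  rw [hω.self_eq_zero hs, Real.zero_rpow hγ.ne', mul_zero] at this
  exact sub_eq_zero.1 (abs_nonpos_iff.1 this)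

theorem strictMono (h : IsFlow T ω γ θ C L ε μ φ) (hL : 1 ≤ L) (hs : s ∈ Icc 0 T)
    (ht : t ∈ Icc 0 T) (hst : s ≤ t) : StrictMono (φ s t) := by
  intro x y hxy
  have h1 := (h.bilipschitz s hs t ht hst x y hxy.le).1
  have h2 : 0 < L⁻¹ * (y - x) := mul_pos (by positivity) (sub_pos.2 hxy)
  linarith

theorem lipschitz (h : IsFlow T ω γ θ C L ε μ φ) (hL : 1 ≤ L) (hs : s ∈ Icc 0 T)
    (ht : t ∈ Icc 0 T) (hst : s ≤ t) (x y : ℝ) : |φ s t x - φ s t y| ≤ L * |x - y| := by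
  wlog hxy : y ≤ x generalizing x y
  · rw [abs_sub_comm, abs_sub_comm x]
    exact this y x (le_of_not_ge hxy)
  rw [abs_of_nonneg (sub_nonneg.2 hxy),
    abs_of_nonneg (sub_nonneg.2 ((h.strictMono hL hs ht hst).monotone hxy))]
  exact (h.bilipschitz s hs t ht hst y x hxy).2

theorem continuous (h : IsFlow T ω γ θ C L ε μ φ) (hL : 1 ≤ L) (hs : s ∈ Icc 0 T)
    (ht : t ∈ Icc 0 T) (hst : s ≤ t) : Continuous (φ s t) := by
  refine (LipschitzWith.of_dist_le_mul (K := L.toNNReal) fun x y => ?_).continuous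
  rw [Real.dist_eq, Real.dist_eq, Real.coe_toNNReal L (by linarith)]
  exact h.lipschitz hL hs ht hst x y

theorem surjective (h : IsFlow T ω γ θ C L ε μ φ) (hL : 1 ≤ L) (hs : s ∈ Icc 0 T)
    (ht : t ∈ Icc 0 T) (hst : s ≤ t) : Function.Surjective (φ s t) := by
  refine (h.continuous hL hs ht hst).surjective ?_ ?_
  · refine tendsto_atTop_mono (fun x => ?_) (tendsto_atTop_add_const_right atTop
      (-(C * ω s t ^ γ)) tendsto_id)
    have := (abs_le.1 (h.near_id s hs t ht hst x)).1
    simp only [id]; linarith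
  · refine tendsto_atBot_mono (fun x => ?_) (tendsto_atBot_add_const_right atBot
      (C * ω s t ^ γ) tendsto_id)
    have := (abs_le.1 (h.near_id s hs t ht hst x)).2
    simp only [id]; linarith

end IsFlow

/-- On short intervals `φ s t` is a perturbation of the identity with Lipschitz constant at most
`1/2`, hence increasing and bi-Lipschitz with constant `2`. Finitely many compositions cover `[0,
T]`: bi-Lipschitz constants multiply and displacement constants add. -/
theorem IsApproxFlow.exists_isFlow {T : ℝ} {ω : ℝ → ℝ → ℝ} {γ θ K R : ℝ}
    {μ : ℝ → ℝ → ℝ → ℝ} (h : IsApproxFlow (Icc 0 T) ω γ θ K R μ) (hT : 0 ≤ T)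
    (hω : IsControl (Icc 0 T) ω) (hr : IsRegular (Icc 0 T) ω)
    (hγ : 0 < γ) (hγθ : γ ≤ θ) (hθ : 1 < θ) (hK : 0 ≤ K) (hR : 0 < R) :
    ∃ φ : ℝ → ℝ → ℝ → ℝ, ∃ ε > 0, ε ≤ R ∧ ε ≤ 1 ∧ ∃ C ≥ 0, ∃ L ≥ 1,
      IsFlow T ω γ θ C L ε μ φ := by
  obtain ⟨φ, ε₀, hε₀, hε₀R, hε₀1, C₀, hC₀, hflow, hnear, hlip⟩ := h.exists_flow hω hr hγ hθ hK hR
  have hpow : ∀ s ∈ Icc 0 T, ∀ t ∈ Icc 0 T, s ≤ t → ω s t ≤ ε₀ → ω s t ^ θ ≤ ω s t ^ γ := by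
    intro s hs t ht hst hW
    exact Real.rpow_le_rpow_of_exponent_ge_of_imp (hω.nonneg s hs t ht hst) (hW.trans hε₀1)
      hγθ (fun _ h => absurd h (zero_lt_one.trans hθ).ne')
  have near : ∀ s ∈ Icc 0 T, ∀ t ∈ Icc 0 T, s ≤ t → ω s t ≤ ε₀ → ∀ x,
      |φ s t x - x| ≤ (K + C₀) * ω s t ^ γ := by
    intro s hs t ht hst hW x
    have h1 := hnear s hs t ht hst hW x
    have h2 := h.near_id s hs t ht hst (hW.trans hε₀R) x
    have h3 := mul_le_mul_of_nonneg_left (hpow s hs t ht hst hW) hC₀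
    have h4 := abs_sub_le (φ s t x) (μ s t x) x
    linarith
  have nearlip : ∀ s ∈ Icc 0 T, ∀ t ∈ Icc 0 T, s ≤ t → ω s t ≤ ε₀ → ∀ x y,
      |(φ s t x - x) - (φ s t y - y)| ≤ (K + C₀) * ω s t ^ γ * |x - y| := by
    intro s hs t ht hst hW x y
    have h1 := hlip s hs t ht hst hW x y
    have h2 := h.near_id_lipschitz hs ht hst (hW.trans hε₀R) x y
    have h3 := mul_le_mul_of_nonneg_right
      (mul_le_mul_of_nonneg_left (hpow s hs t ht hst hW) hC₀) (abs_nonneg (x - y))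
    have h4 := abs_add_le (φ s t x - φ s t y - (μ s t x - μ s t y)) (μ s t x - x - (μ s t y - y))
    rw [show φ s t x - φ s t y - (μ s t x - μ s t y) + (μ s t x - x - (μ s t y - y)) =
      φ s t x - x - (φ s t y - y) by ring] at h4
    linarith
  obtain ⟨δ, hδ, hδε⟩ := hr.exists_le hε₀
  -- The threshold makes `(K + C₀) * ω ^ γ ≤ 1/2`.
  obtain ⟨δ', hδ', hδε'⟩ := hr.exists_le (ε := (1 / (2 * (K + C₀ + 1))) ^ (1 / γ)) (by positivity)
  have hδ'' : 0 < min δ δ' := lt_min hδ hδ'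
  have h0T : (0 : ℝ) ∈ Icc 0 T := ⟨le_rfl, hT⟩
  have hTT : T ∈ Icc 0 T := ⟨hT, le_rfl⟩
  have hbi : ∃ L ≥ 1, ∀ u ∈ Icc 0 T, ∀ v ∈ Icc 0 T, 0 ≤ u → v ≤ T → u ≤ v → ∀ x y, x ≤ y →
      L⁻¹ * (y - x) ≤ φ u v y - φ u v x ∧ φ u v y - φ u v x ≤ L * (y - x) := by
    -- The property ranges over all subintervals of `[s, t]`, so that its instance on `[0, T]`
    -- provides one constant for all pairs of times.
    refine interval_concat_induction (T := T) (Q := fun s t => ∃ L ≥ 1, ∀ u ∈ Icc 0 T,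
      ∀ v ∈ Icc 0 T, s ≤ u → v ≤ t → u ≤ v → ∀ x y, x ≤ y →
      L⁻¹ * (y - x) ≤ φ u v y - φ u v x ∧ φ u v y - φ u v x ≤ L * (y - x)) hδ'' ?_ ?_ 0 h0T T hTT hT
    · intro s hs t ht hst hd
      refine ⟨2, by norm_num, fun u hu v hv hsu hvt huv x y hxy => ?_⟩
      have hd' : v - u < min δ δ' := by linarith
      have h1 := nearlip u hu v hv huv (hδε u hu v hv huv (hd'.trans_le (min_le_left _ _))) x y
      have h2 : ω u v ^ γ ≤ 1 / (2 * (K + C₀ + 1)) := by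
        calc ω u v ^ γ ≤ ((1 / (2 * (K + C₀ + 1))) ^ (1 / γ)) ^ γ :=
              Real.rpow_le_rpow (hω.nonneg u hu v hv huv)
                (hδε' u hu v hv huv (hd'.trans_le (min_le_right _ _))) hγ.le
          _ = _ := by rw [← Real.rpow_mul (by positivity), one_div_mul_cancel hγ.ne', Real.rpow_one]
      have h3 : (K + C₀) * ω u v ^ γ ≤ 1 / 2 := by
        calc (K + C₀) * ω u v ^ γ ≤ (K + C₀) * (1 / (2 * (K + C₀ + 1))) := by gcongr
          _ ≤ 1 / 2 := by
            rw [mul_one_div, div_le_div_iff₀ (by positivity) (by positivity)]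
            linarith
      have h4 := h1.trans (mul_le_mul_of_nonneg_right h3 (abs_nonneg (x - y)))
      rw [abs_sub_comm x y, abs_of_nonneg (sub_nonneg.2 hxy), abs_le] at h4
      constructor <;> linarith [h4.1, h4.2]
    · rintro s hs w hw t ht hsw hwt ⟨L, hL, hQ⟩ ⟨L', hL', hQ'⟩
      have hinv : ∀ {a b : ℝ}, 1 ≤ a → a ≤ b → ∀ {z : ℝ}, 0 ≤ z → b⁻¹ * z ≤ a⁻¹ * z :=
        fun ha hab _ hz => mul_le_mul_of_nonneg_right (inv_anti₀ (by linarith) hab) hz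
      have hLL : L ≤ L' * L := le_mul_of_one_le_left (by linarith) hL'
      have hLL' : L' ≤ L' * L := le_mul_of_one_le_right (by linarith) hL
      refine ⟨L' * L, hL.le.trans hLL, fun u hu v hv hsu hvt huv x y hxy => ?_⟩
      have hz : 0 ≤ y - x := sub_nonneg.2 hxy
      rcases le_total v w with hvw | hwv
      · obtain ⟨h1, h2⟩ := hQ u hu v hv hsu hvw huv x y hxy
        exact ⟨(hinv hL hLL hz).trans h1, h2.trans (mul_le_mul_of_nonneg_right hLL hz)⟩
      rcases le_total w u with hwu | huw
      · obtain ⟨h1, h2⟩ := hQ' u hu v hv hwu hvt huv x y hxy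
        exact ⟨(hinv hL' hLL' hz).trans h1, h2.trans (mul_le_mul_of_nonneg_right hLL' hz)⟩
      · obtain ⟨h1, h2⟩ := hQ u hu w hw hsu le_rfl huw x y hxy
        have hz' : 0 ≤ φ u w y - φ u w x := le_trans (by positivity) h1
        obtain ⟨h3, h4⟩ := hQ' w hw v hv le_rfl hvt hwv _ _ (sub_nonneg.1 hz')
        rw [hflow u hu w hw v hv huw hwv, hflow u hu w hw v hv huw hwv] at h3 h4
        rw [mul_inv, mul_assoc, mul_assoc]
        exact ⟨(mul_le_mul_of_nonneg_left h1 (by positivity)).trans h3,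
          h4.trans (mul_le_mul_of_nonneg_left h2 (by positivity))⟩
  have hnr : ∃ C ≥ 0, ∀ u ∈ Icc 0 T, ∀ v ∈ Icc 0 T, 0 ≤ u → v ≤ T → u ≤ v → ∀ x,
      |φ u v x - x| ≤ C * ω u v ^ γ := by
    refine interval_concat_induction (T := T) (Q := fun s t => ∃ C ≥ 0, ∀ u ∈ Icc 0 T,
      ∀ v ∈ Icc 0 T, s ≤ u → v ≤ t → u ≤ v → ∀ x,
      |φ u v x - x| ≤ C * ω u v ^ γ) hδ ?_ ?_ 0 h0T T hTT hT
    · intro s hs t ht hst hd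
      exact ⟨K + C₀, by positivity, fun u hu v hv hsu hvt huv x =>
        near u hu v hv huv (hδε u hu v hv huv (by linarith)) x⟩
    · rintro s hs w hw t ht hsw hwt ⟨C, hC, hQ⟩ ⟨C', hC', hQ'⟩
      refine ⟨C' + C, by positivity, fun u hu v hv hsu hvt huv x => ?_⟩
      have h0 := Real.rpow_nonneg (hω.nonneg u hu v hv huv) γ
      rcases le_total v w with hvw | hwv
      · have := hQ u hu v hv hsu hvw huv x
        nlinarith
      rcases le_total w u with hwu | huw
      · have := hQ' u hu v hv hwu hvt huv x
        nlinarith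
      · have h1 := hQ u hu w hw hsu le_rfl huw x
        have h2 := hQ' w hw v hv le_rfl hvt hwv (φ u w x)
        rw [hflow u hu w hw v hv huw hwv] at h2
        have h3 := abs_sub_le (φ u v x) (φ u w x) x
        have h4 : ω u w ^ γ ≤ ω u v ^ γ := Real.rpow_le_rpow (hω.nonneg u hu w hw huw)
          (hω.mono_right hu hw hv huw hwv) hγ.le
        have h5 : ω w v ^ γ ≤ ω u v ^ γ := Real.rpow_le_rpow (hω.nonneg w hw v hv hwv)
          (hω.mono_left hu hw hv huw hwv) hγ.le
        nlinarith
  obtain ⟨L, hL, hbi⟩ := hbi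
  obtain ⟨C, hC, hnr⟩ := hnr
  refine ⟨φ, ε₀, hε₀, hε₀R, hε₀1, C + (K + C₀), by positivity, L, hL, hflow, ?_, ?_, ?_, ?_⟩
  · exact fun s hs t ht hst => hbi s hs t ht hs.1 ht.2 hst
  · intro s hs t ht hst x
    have := Real.rpow_nonneg (hω.nonneg s hs t ht hst) γ
    refine (hnr s hs t ht hs.1 ht.2 hst x).trans (mul_le_mul_of_nonneg_right ?_ this)
    linarith
  · intro s hs t ht hst hW x y
    have := Real.rpow_nonneg (hω.nonneg s hs t ht hst) γ
    refine (nearlip s hs t ht hst hW x y).trans (mul_le_mul_of_nonneg_right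
      (mul_le_mul_of_nonneg_right ?_ this) (abs_nonneg _))
    linarith
  · intro s hs t ht hst hW x
    have := Real.rpow_nonneg (hω.nonneg s hs t ht hst) θ
    refine (hnear s hs t ht hst hW x).trans (mul_le_mul_of_nonneg_right ?_ this)
    linarith

/-! ### Taylor estimates and the defect of second order expansions -/

/-- `g` has the derivatives `g'` and `g''`, and all three are bounded by `c`. -/
structure IsBoundedC2 (c : ℝ) (g g' g'' : ℝ → ℝ) : Prop where
  hasDerivAt : ∀ x, HasDerivAt g (g' x) x
  hasDerivAt' : ∀ x, HasDerivAt g' (g'' x) x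
  bound : ∀ x, |g x| ≤ c
  bound' : ∀ x, |g' x| ≤ c
  bound'' : ∀ x, |g'' x| ≤ c

theorem abs_sub_le_of_hasDerivAt {g g' : ℝ → ℝ} {c : ℝ} (hg : ∀ x, HasDerivAt g (g' x) x)
    (hb : ∀ x, |g' x| ≤ c) (x y : ℝ) : |g x - g y| ≤ c * |x - y| :=
  convex_univ.norm_image_sub_le_of_norm_hasDerivWithin_le (f := g) (f' := g')
    (fun z _ => (hg z).hasDerivWithinAt) (fun z _ => hb z) (mem_univ y) (mem_univ x)

namespace IsBoundedC2

variable {c c' : ℝ} {g g' g'' k k' k'' : ℝ → ℝ}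

theorem add (h : IsBoundedC2 c g g' g'') (h' : IsBoundedC2 c' k k' k'') :
    IsBoundedC2 (c + c') (fun x => g x + k x) (fun x => g' x + k' x) (fun x => g'' x + k'' x) :=
  ⟨fun x => (h.hasDerivAt x).add (h'.hasDerivAt x),
    fun x => (h.hasDerivAt' x).add (h'.hasDerivAt' x),
    fun x => (abs_add_le _ _).trans (add_le_add (h.bound x) (h'.bound x)),
    fun x => (abs_add_le _ _).trans (add_le_add (h.bound' x) (h'.bound' x)),
    fun x => (abs_add_le _ _).trans (add_le_add (h.bound'' x) (h'.bound'' x))⟩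

theorem mono (h : IsBoundedC2 c g g' g'') (hc : c ≤ c') : IsBoundedC2 c' g g' g'' :=
  ⟨h.1, h.2, fun x => (h.bound x).trans hc, fun x => (h.bound' x).trans hc,
    fun x => (h.bound'' x).trans hc⟩

theorem lipschitz (h : IsBoundedC2 c g g' g'') (x y : ℝ) : |g x - g y| ≤ c * |x - y| :=
  abs_sub_le_of_hasDerivAt h.hasDerivAt h.bound' x y

theorem lipschitz' (h : IsBoundedC2 c g g' g'') (x y : ℝ) : |g' x - g' y| ≤ c * |x - y| :=
  abs_sub_le_of_hasDerivAt h.hasDerivAt' h.bound'' x y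

theorem taylor (h : IsBoundedC2 c g g' g'') (x z : ℝ) :
    |g (x + z) - g x - g' x * z| ≤ c * |z| ^ 2 := by
  have hc : 0 ≤ c := (abs_nonneg _).trans (h.bound 0)
  have hd : ∀ r : ℝ, HasDerivAt (fun r : ℝ => g (x + r * z) - r * (g' x * z))
      (g' (x + r * z) * z - g' x * z) r := by
    intro r
    have h1 : HasDerivAt (fun r : ℝ => x + r * z) z r := by
      simpa using ((hasDerivAt_id r).mul_const z).const_add x
    have h2 : HasDerivAt (fun r : ℝ => r * (g' x * z)) (g' x * z) r := by
      simpa using (hasDerivAt_id r).mul_const (g' x * z)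
    exact ((h.hasDerivAt (x + r * z)).comp r h1).sub h2
  have := norm_image_sub_le_of_norm_deriv_le_segment_01' (C := c * |z| ^ 2)
    (fun r _ => (hd r).hasDerivWithinAt) (fun r hr => ?_)
  · simpa [sub_right_comm] using this
  · rw [← sub_mul, norm_mul, Real.norm_eq_abs, Real.norm_eq_abs]
    have h1 := h.lipschitz' (x + r * z) x
    rw [add_sub_cancel_left, abs_mul, abs_of_nonneg hr.1] at h1
    have h2 : r * |z| ≤ |z| := mul_le_of_le_one_left (abs_nonneg z) hr.2.le
    nlinarith [abs_nonneg z, mul_le_mul_of_nonneg_left h2 hc]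

/-- The two differences are interpolated along the segments from `q` to `p` and from `s` to `r`, and
the mean value inequality is applied to the difference of the interpolations. -/
theorem second_diff (h : IsBoundedC2 c g g' g'') (p q r s : ℝ) :
    |g p - g q - g r + g s| ≤ c * (|p - q - r + s| + |r - s| * (|p - r| + |q - s|)) := by
  have hc : 0 ≤ c := (abs_nonneg _).trans (h.bound 0)
  have hl : ∀ a b τ : ℝ, HasDerivAt (fun τ : ℝ => g (b + τ * (a - b)))
      (g' (b + τ * (a - b)) * (a - b)) τ := by
    intro a b τ
    have h1 : HasDerivAt (fun τ : ℝ => b + τ * (a - b)) (a - b) τ := by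
      simpa using ((hasDerivAt_id τ).mul_const (a - b)).const_add b
    exact (h.hasDerivAt _).comp τ h1
  have := norm_image_sub_le_of_norm_deriv_le_segment_01'
    (C := c * (|p - q - r + s| + |r - s| * (|p - r| + |q - s|)))
    (fun τ _ => ((hl p q τ).sub (hl r s τ)).hasDerivWithinAt) (fun τ hτ => ?_)
  · have e : g p - g q - g r + g s = g (q + 1 * (p - q)) - g (s + 1 * (r - s)) -
        (g (q + 0 * (p - q)) - g (s + 0 * (r - s))) := by
      simp only [one_mul, zero_mul, add_zero, add_sub_cancel]; ring
    rw [e]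
    exact this
  · set P := q + τ * (p - q)
    set S := s + τ * (r - s)
    have e : g' P * (p - q) - g' S * (r - s) =
        g' P * (p - q - r + s) + (g' P - g' S) * (r - s) := by ring
    have hPS : |P - S| ≤ |p - r| + |q - s| := by
      have e2 : P - S = (1 - τ) * (q - s) + τ * (p - r) := by simp only [P, S]; ring
      rw [e2]
      refine (abs_add_le _ _).trans ?_
      rw [abs_mul, abs_mul, abs_of_nonneg hτ.1, abs_of_nonneg (by linarith [hτ.2])]
      nlinarith [hτ.1, hτ.2, abs_nonneg (p - r), abs_nonneg (q - s)]
    rw [Real.norm_eq_abs, e]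
    refine (abs_add_le _ _).trans ?_
    rw [abs_mul, abs_mul, mul_add]
    refine add_le_add (mul_le_mul_of_nonneg_right (h.bound' P) (abs_nonneg _)) ?_
    calc |g' P - g' S| * |r - s| ≤ c * (|p - r| + |q - s|) * |r - s| := by
          gcongr
          exact (h.lipschitz' P S).trans (mul_le_mul_of_nonneg_left hPS hc)
      _ = _ := by ring

end IsBoundedC2

section Composition

variable {M ε : ℝ} {α α' α'' A A' A'' β β' β'' β''' B B' B'' : ℝ → ℝ}

/-- The error made in composing two second order expansions. -/
theorem abs_expansion_defect_le (hε : 0 ≤ ε) (hε1 : ε ≤ 1)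
    (hα : IsBoundedC2 (M * ε) α α' α'') (hA : IsBoundedC2 (M * ε ^ 2) A A' A'')
    (hβ : IsBoundedC2 (M * ε) β β' β'') (hB : IsBoundedC2 (M * ε ^ 2) B B' B'')
    (hM : 0 ≤ M) (x : ℝ) :
    |β (x + (α x + A x)) - β x + (B (x + (α x + A x)) - B x) - β' x * α x| ≤
      (4 * M ^ 3 + 3 * M ^ 2) * ε ^ 3 := by
  set P := α x + A x with hP
  have hεε : M * ε ^ 2 ≤ M * ε := mul_le_mul_of_nonneg_left (by nlinarith) hM
  have hPb : |P| ≤ 2 * (M * ε) := by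
    have := (hα.add hA).bound x
    linarith
  have e1 : |β (x + P) - β x - β' x * P| ≤ M * ε * (2 * (M * ε)) ^ 2 :=
    (hβ.taylor x P).trans (by gcongr)
  have e2 : |β' x * A x| ≤ M * ε * (M * ε ^ 2) := by
    rw [abs_mul]
    exact mul_le_mul (hβ.bound' x) (hA.bound x) (abs_nonneg _) (by positivity)
  have e3 : |B (x + P) - B x| ≤ M * ε ^ 2 * (2 * (M * ε)) := by
    have := hB.lipschitz (x + P) x
    rw [add_sub_cancel_left] at this
    exact this.trans (by gcongr)
  -- Up to a Taylor remainder, subtracting `β' x * α x` removes the only second order contribution;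
  -- each of the three terms left is of order `ε ^ 3`.
  have e : β (x + P) - β x + (B (x + P) - B x) - β' x * α x =
      (β (x + P) - β x - β' x * P) + β' x * A x + (B (x + P) - B x) := by rw [hP]; ring
  rw [e]
  refine (abs_add_three _ _ _).trans ((add_le_add (add_le_add e1 e2) e3).trans (le_of_eq ?_))
  ring

/-- The derivative in `x` of the defect is itself of order `ε ^ 3`, and the mean value inequality
concludes. Expanding `β'` to second order requires the third derivative of `β`, which is where three
derivatives of `f` are needed. -/
theorem abs_expansion_defect_sub_le (hε : 0 ≤ ε) (hε1 : ε ≤ 1)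
    (hα : IsBoundedC2 (M * ε) α α' α'') (hA : IsBoundedC2 (M * ε ^ 2) A A' A'')
    (hβ : IsBoundedC2 (M * ε) β β' β'') (hβ' : IsBoundedC2 (M * ε) β' β'' β''')
    (hB : IsBoundedC2 (M * ε ^ 2) B B' B'') (hM : 0 ≤ M) (x y : ℝ) :
    |(β (x + (α x + A x)) - β x + (B (x + (α x + A x)) - B x) - β' x * α x) -
      (β (y + (α y + A y)) - β y + (B (y + (α y + A y)) - B y) - β' y * α y)| ≤
      (8 * M ^ 3 + 6 * M ^ 2) * ε ^ 3 * |x - y| := by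
  have hεε : M * ε ^ 2 ≤ M * ε := mul_le_mul_of_nonneg_left (by nlinarith) hM
  refine abs_sub_le_of_hasDerivAt
    (g := fun x => β (x + (α x + A x)) - β x + (B (x + (α x + A x)) - B x) - β' x * α x)
    (g' := fun x => (β' (x + (α x + A x)) * (1 + (α' x + A' x)) - β' x) +
      (B' (x + (α x + A x)) * (1 + (α' x + A' x)) - B' x) - (β'' x * α x + β' x * α' x))
    (fun x => ?_) (fun x => ?_) x y
  · have h1 : HasDerivAt (fun x => x + (α x + A x)) (1 + (α' x + A' x)) x :=
      (hasDerivAt_id x).add ((hα.hasDerivAt x).add (hA.hasDerivAt x))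
    exact ((((hβ.hasDerivAt _).comp x h1).sub (hβ.hasDerivAt x)).add
      (((hB.hasDerivAt _).comp x h1).sub (hB.hasDerivAt x))).sub
      ((hβ.hasDerivAt' x).mul (hα.hasDerivAt x))
  · set P := α x + A x with hP
    set P' := α' x + A' x with hP'
    have hPb : |P| ≤ 2 * (M * ε) := by
      have := (hα.add hA).bound x
      linarith
    have hPb' : |P'| ≤ 2 * (M * ε) := by
      have := (hα.add hA).bound' x
      linarith
    have e1 : |β' (x + P) - β' x - β'' x * P| ≤ M * ε * (2 * (M * ε)) ^ 2 :=
      (hβ'.taylor x P).trans (by gcongr)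
    have e2 : |(β' (x + P) - β' x) * P'| ≤ M * ε * (2 * (M * ε)) * (2 * (M * ε)) := by
      rw [abs_mul]
      have := hβ'.lipschitz (x + P) x
      rw [add_sub_cancel_left] at this
      refine mul_le_mul (this.trans (by gcongr)) hPb' (abs_nonneg _) (by positivity)
    have e3 : |β'' x * A x| ≤ M * ε * (M * ε ^ 2) := by
      rw [abs_mul]
      exact mul_le_mul (hβ.bound'' x) (hA.bound x) (abs_nonneg _) (by positivity)
    have e4 : |β' x * A' x| ≤ M * ε * (M * ε ^ 2) := by
      rw [abs_mul]
      exact mul_le_mul (hβ.bound' x) (hA.bound' x) (abs_nonneg _) (by positivity)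
    have e5 : |B' (x + P) - B' x| ≤ M * ε ^ 2 * (2 * (M * ε)) := by
      have := hB.lipschitz' (x + P) x
      rw [add_sub_cancel_left] at this
      exact this.trans (by gcongr)
    have e6 : |B' (x + P) * P'| ≤ M * ε ^ 2 * (2 * (M * ε)) := by
      rw [abs_mul]
      exact mul_le_mul (hB.bound' _) hPb' (abs_nonneg _) (by positivity)
    have e : β' (x + P) * (1 + P') - β' x + (B' (x + P) * (1 + P') - B' x) -
        (β'' x * α x + β' x * α' x) =
        (β' (x + P) - β' x - β'' x * P) + (β' (x + P) - β' x) * P' + β'' x * A x +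
          β' x * A' x + (B' (x + P) - B' x) + B' (x + P) * P' := by
      rw [hP, hP']; ring
    rw [e]
    have htot : M * ε * (2 * (M * ε)) ^ 2 + M * ε * (2 * (M * ε)) * (2 * (M * ε)) +
        M * ε * (M * ε ^ 2) + M * ε * (M * ε ^ 2) + M * ε ^ 2 * (2 * (M * ε)) +
        M * ε ^ 2 * (2 * (M * ε)) = (8 * M ^ 3 + 6 * M ^ 2) * ε ^ 3 := by ring
    rw [← htot]
    rw [abs_le] at *
    constructor <;> linarith [e1.1, e1.2, e2.1, e2.2, e3.1, e3.2, e4.1, e4.2, e5.1, e5.2, e6.1,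
      e6.2]

end Composition

/-! ### The vector field and its second order term -/

section VectorField

variable {d : ℕ} {f : ℝ → Vec d →L[ℝ] ℝ}

theorem apply_eq_sum (l : Vec d →L[ℝ] ℝ) (a : Vec d) :
    l a = ∑ i, a i * l (EuclideanSpace.single i 1) := by
  conv_lhs => rw [← (EuclideanSpace.basisFun (Fin d) ℝ).sum_repr a]
  simp

/-- On a product `a ⊗ b` the second order term is `(f' b) (f a)`. -/
theorem secondOrder_of_eq_mul (y : ℝ) (a b : Vec d) (A : Mat d)
    (hA : ∀ i j, A (i, j) = a i * b j) : secondOrder f y A = deriv f y b * f y a := by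
  rw [apply_eq_sum (deriv f y) b, apply_eq_sum (f y) a, Finset.sum_mul_sum, secondOrder]
  refine Finset.sum_congr rfl fun i _ => Finset.sum_congr rfl fun j _ => ?_
  rw [hA]; ring

theorem secondOrder_add (y : ℝ) (A B : Mat d) :
    secondOrder f y (A + B) = secondOrder f y A + secondOrder f y B := by
  simp only [secondOrder, ← Finset.sum_add_distrib]
  refine Finset.sum_congr rfl fun i _ => Finset.sum_congr rfl fun j _ => ?_
  simp only [PiLp.add_apply]; ring

theorem IsCb.hasDerivAt_iteratedDeriv {F : Type*} [NormedAddCommGroup F] [NormedSpace ℝ F] {n : ℕ}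
    {f : ℝ → F} (hf : IsCb n f) {k : ℕ} (hk : k < n) (x : ℝ) :
    HasDerivAt (iteratedDeriv k f) (iteratedDeriv (k + 1) f x) x := by
  have := (hf.1.differentiable_iteratedDeriv k (by exact_mod_cast hk)) x
  rw [iteratedDeriv_succ]
  exact this.hasDerivAt

theorem IsCb.exists_bound {F : Type*} [NormedAddCommGroup F] [NormedSpace ℝ F] {n : ℕ}
    {f : ℝ → F} (hf : IsCb n f) : ∃ C ≥ 0, ∀ k ≤ n, ∀ x, ‖iteratedDeriv k f x‖ ≤ C := by
  choose! C hC using hf.2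
  refine ⟨∑ k ∈ Finset.range (n + 1), |C k|, Finset.sum_nonneg fun _ _ => abs_nonneg _, ?_⟩
  intro k hk x
  refine (hC k hk x).trans ((le_abs_self _).trans ?_)
  exact Finset.single_le_sum (f := fun k => |C k|) (fun _ _ => abs_nonneg _)
    (Finset.mem_range.2 (by omega))

theorem hasDerivAt_apply {g : ℝ → Vec d →L[ℝ] ℝ} {g' : Vec d →L[ℝ] ℝ} {x : ℝ}
    (h : HasDerivAt g g' x) (a : Vec d) : HasDerivAt (fun y => g y a) (g' a) x := by
  simpa using h.clm_apply (hasDerivAt_const x a)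

theorem abs_apply_le {l : Vec d →L[ℝ] ℝ} {C : ℝ} (h : ‖l‖ ≤ C) (a : Vec d) : |l a| ≤ C * ‖a‖ :=
  (l.le_opNorm a).trans (mul_le_mul_of_nonneg_right h (norm_nonneg a))

/-- The first order term and its derivative are `C²`, with bounds linear in the increment. -/
theorem IsCb.isBoundedC2_apply (hf : IsCb 3 f) {C : ℝ}
    (hC : ∀ k ≤ 3, ∀ x, ‖iteratedDeriv k f x‖ ≤ C) {k : ℕ} (hk : k + 2 ≤ 3) (a : Vec d) :
    IsBoundedC2 (C * ‖a‖) (fun x => iteratedDeriv k f x a)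
      (fun x => iteratedDeriv (k + 1) f x a) (fun x => iteratedDeriv (k + 2) f x a) :=
  ⟨fun x => hasDerivAt_apply (hf.hasDerivAt_iteratedDeriv (by omega) x) a,
    fun x => hasDerivAt_apply (hf.hasDerivAt_iteratedDeriv (by omega) x) a,
    fun x => abs_apply_le (hC _ (by omega) x) a, fun x => abs_apply_le (hC _ (by omega) x) a,
    fun x => abs_apply_le (hC _ (by omega) x) a⟩

/-- The second order term is `C²`, with bounds linear in the increment. -/
theorem IsCb.isBoundedC2_secondOrder (hf : IsCb 3 f) {C : ℝ} (hC0 : 0 ≤ C)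
    (hC : ∀ k ≤ 3, ∀ x, ‖iteratedDeriv k f x‖ ≤ C) (A : Mat d) :
    ∃ S' S'' : ℝ → ℝ,
      IsBoundedC2 (d * (d * (4 * C ^ 2 * ‖A‖))) (fun x => secondOrder f x A) S' S'' := by
  have hder : ∀ k < 3, ∀ (i : Fin d) (x : ℝ), HasDerivAt
      (fun y => iteratedDeriv k f y (EuclideanSpace.single i 1))
      (iteratedDeriv (k + 1) f x (EuclideanSpace.single i 1)) x :=
    fun k hk i x => hasDerivAt_apply (hf.hasDerivAt_iteratedDeriv hk x) _
  have hb : ∀ k ≤ 3, ∀ (i : Fin d) (x : ℝ),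
      |iteratedDeriv k f x (EuclideanSpace.single i 1)| ≤ C := by
    intro k hk i x
    simpa using abs_apply_le (hC k hk x) (EuclideanSpace.single i (1 : ℝ))
  have hAb : ∀ i j, |A (j, i)| ≤ ‖A‖ := fun i j => PiLp.norm_apply_le A (j, i)
  have hsum : ∀ (F : Fin d → Fin d → ℝ) (c : ℝ), (∀ i j, |F i j| ≤ c) →
      |∑ i, ∑ j, F i j| ≤ d * (d * c) := by
    intro F c hF
    calc |∑ i, ∑ j, F i j| ≤ ∑ i : Fin d, ∑ j : Fin d, c :=
          (Finset.abs_sum_le_sum_abs _ _).trans (Finset.sum_le_sum fun i _ =>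
            (Finset.abs_sum_le_sum_abs _ _).trans (Finset.sum_le_sum fun j _ => hF i j))
      _ = d * (d * c) := by simp
  set e : ℕ → Fin d → ℝ → ℝ := fun k i x => iteratedDeriv k f x (EuclideanSpace.single i 1) with he
  have hprod : ∀ k ≤ 3, ∀ l ≤ 3, ∀ i j x, |e k i x * e l j x| ≤ C ^ 2 := by
    intro k hk l hl i j x
    rw [abs_mul, sq]
    exact mul_le_mul (hb k hk i x) (hb l hl j x) (abs_nonneg _) hC0
  have hterm : ∀ (z : ℝ) i j, |z| ≤ 4 * C ^ 2 → |z * A (j, i)| ≤ 4 * C ^ 2 * ‖A‖ := by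
    intro z i j hz
    rw [abs_mul]
    exact mul_le_mul hz (hAb i j) (abs_nonneg _) (by positivity)
  have hS : ∀ x, secondOrder f x A = ∑ i, ∑ j, e 1 i x * e 0 j x * A (j, i) := by
    intro x
    simp [secondOrder, he, iteratedDeriv_one, iteratedDeriv_zero]
  -- The second derivative of a product has four terms, each at most `C ^ 2`: hence the factor `4`,
  -- used for the lower derivatives as well.
  have hC2 : 0 ≤ C ^ 2 := by positivity
  refine ⟨fun x => ∑ i, ∑ j, (e 2 i x * e 0 j x + e 1 i x * e 1 j x) * A (j, i),
    fun x => ∑ i, ∑ j, ((e 3 i x * e 0 j x + e 2 i x * e 1 j x) +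
      (e 2 i x * e 1 j x + e 1 i x * e 2 j x)) * A (j, i), fun x => ?_, fun x => ?_,
    fun x => ?_, fun x => ?_, fun x => ?_⟩
  · simp only [hS]
    refine HasDerivAt.fun_sum fun i _ => HasDerivAt.fun_sum fun j _ => ?_
    exact ((hder 1 (by norm_num) i x).mul (hder 0 (by norm_num) j x)).mul_const _
  · refine HasDerivAt.fun_sum fun i _ => HasDerivAt.fun_sum fun j _ => ?_
    exact (((hder 2 (by norm_num) i x).mul (hder 0 (by norm_num) j x)).add
      ((hder 1 (by norm_num) i x).mul (hder 1 (by norm_num) j x))).mul_const _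
  · rw [hS]
    refine hsum _ _ fun i j => hterm _ i j ?_
    have := hprod 1 (by norm_num) 0 (by norm_num) i j x
    linarith
  · refine hsum _ _ fun i j => hterm _ i j ((abs_add_le _ _).trans ?_)
    have h1 := hprod 2 (by norm_num) 0 (by norm_num) i j x
    have h2 := hprod 1 (by norm_num) 1 (by norm_num) i j x
    linarith
  · refine hsum _ _ fun i j => hterm _ i j ((abs_add_le _ _).trans
      (add_le_add (abs_add_le _ _) (abs_add_le _ _) |>.trans ?_))
    have h1 := hprod 3 (by norm_num) 0 (by norm_num) i j x
    have h2 := hprod 2 (by norm_num) 1 (by norm_num) i j x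
    have h3 := hprod 1 (by norm_num) 2 (by norm_num) i j x
    linarith

end VectorField

/-! ### The rough expansion as an approximate flow -/

/-- The second order expansion of the flow of the rough differential equation `dy = f(y) dX`. -/
noncomputable def roughExpansion {d : ℕ} (f : ℝ → Vec d →L[ℝ] ℝ) (X1 : ℝ → ℝ → Vec d)
    (X2 : ℝ → ℝ → Mat d) (s t x : ℝ) : ℝ :=
  x + (f x (X1 s t) + secondOrder f x (X2 s t))

/-- A rough path is dominated by a single regular control. -/
theorem IsRoughPath.exists_control {d : ℕ} {p T : ℝ} {X1 : ℝ → ℝ → Vec d} {X2 : ℝ → ℝ → Mat d}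
    (hX : IsRoughPath p T X1 X2) (hp : 0 < p) : ∃ ω : ℝ → ℝ → ℝ, IsControl (Icc 0 T) ω ∧
      IsRegular (Icc 0 T) ω ∧
      (∀ s ∈ Icc 0 T, ∀ t ∈ Icc 0 T, s ≤ t → ‖X1 s t‖ ≤ ω s t ^ (1 / p)) ∧
      (∀ s ∈ Icc 0 T, ∀ t ∈ Icc 0 T, s ≤ t → ‖X2 s t‖ ≤ (ω s t ^ (1 / p)) ^ 2) := by
  obtain ⟨ω₁, hω₁, hr₁, h₁⟩ := hX.mem_one.2.2
  obtain ⟨ω₂, hω₂, hr₂, h₂⟩ := hX.mem_two.2.2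
  refine ⟨_, hω₁.add hω₂, hr₁.add hr₂, fun s hs t ht hst => ?_, fun s hs t ht hst => ?_⟩
  · have h0 := hω₁.nonneg s hs t ht hst
    have h0' := hω₂.nonneg s hs t ht hst
    refine (h₁ s hs t ht hst).trans (Real.rpow_le_rpow h0 (by linarith) (by positivity))
  · have h0 := hω₁.nonneg s hs t ht hst
    have h0' := hω₂.nonneg s hs t ht hst
    refine (h₂ s hs t ht hst).trans ?_
    rw [← Real.rpow_natCast, ← Real.rpow_mul (add_nonneg h0 h0')]
    rw [show 1 / p * ((2 : ℕ) : ℝ) = 1 / (p / 2) by push_cast; field_simp]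
    exact Real.rpow_le_rpow h0' (by linarith) (by positivity)

/-- The second order expansion is an approximate flow. -/
theorem IsRoughPath.exists_isApproxFlow {d : ℕ} {p T : ℝ} {X1 : ℝ → ℝ → Vec d}
    {X2 : ℝ → ℝ → Mat d} (hX : IsRoughPath p T X1 X2) (hp : 0 < p)
    {f : ℝ → Vec d →L[ℝ] ℝ} (hf : IsCb 3 f) {ω : ℝ → ℝ → ℝ} (hω : IsControl (Icc 0 T) ω)
    (h1 : ∀ s ∈ Icc 0 T, ∀ t ∈ Icc 0 T, s ≤ t → ‖X1 s t‖ ≤ ω s t ^ (1 / p))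
    (h2 : ∀ s ∈ Icc 0 T, ∀ t ∈ Icc 0 T, s ≤ t → ‖X2 s t‖ ≤ (ω s t ^ (1 / p)) ^ 2) :
    ∃ K ≥ 0, IsApproxFlow (Icc 0 T) ω (1 / p) (3 / p) K 1 (roughExpansion f X1 X2) := by
  obtain ⟨C, hC0, hC⟩ := hf.exists_bound
  set M := C + d * (d * (4 * C ^ 2)) with hM
  have hM0 : 0 ≤ M := by positivity
  have hCM : C ≤ M := le_add_of_nonneg_right (by positivity)
  have hSM : d * (d * (4 * C ^ 2)) ≤ M := le_add_of_nonneg_left hC0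
  have first : ∀ (k : ℕ), k + 2 ≤ 3 → ∀ (a : Vec d) (ε : ℝ), ‖a‖ ≤ ε → IsBoundedC2 (M * ε)
      (fun x => iteratedDeriv k f x a) (fun x => iteratedDeriv (k + 1) f x a)
      (fun x => iteratedDeriv (k + 2) f x a) := fun k hk a ε ha =>
    (hf.isBoundedC2_apply hC hk a).mono (mul_le_mul hCM ha (norm_nonneg a) hM0)
  have second : ∀ (A : Mat d) (ε : ℝ), ‖A‖ ≤ ε ^ 2 → ∃ S' S'' : ℝ → ℝ,
      IsBoundedC2 (M * ε ^ 2) (fun x => secondOrder f x A) S' S'' := by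
    intro A ε hA
    obtain ⟨S', S'', h⟩ := hf.isBoundedC2_secondOrder hC0 hC A
    refine ⟨S', S'', h.mono ?_⟩
    calc d * (d * (4 * C ^ 2 * ‖A‖)) = d * (d * (4 * C ^ 2)) * ‖A‖ := by ring
      _ ≤ M * ε ^ 2 := mul_le_mul hSM hA (norm_nonneg A) hM0
  have hε : ∀ s ∈ Icc 0 T, ∀ t ∈ Icc 0 T, s ≤ t → ω s t ≤ 1 →
      0 ≤ ω s t ^ (1 / p) ∧ ω s t ^ (1 / p) ≤ 1 := fun s hs t ht hst hW =>
    ⟨Real.rpow_nonneg (hω.nonneg s hs t ht hst) _,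
      Real.rpow_le_one (hω.nonneg s hs t ht hst) hW (by positivity)⟩
  have hcube : ∀ s ∈ Icc 0 T, ∀ t ∈ Icc 0 T, s ≤ t → (ω s t ^ (1 / p)) ^ 3 = ω s t ^ (3 / p) := by
    intro s hs t ht hst
    rw [← Real.rpow_natCast, ← Real.rpow_mul (hω.nonneg s hs t ht hst)]
    congr 1; push_cast; ring
  have hincr : ∀ s ∈ Icc 0 T, ∀ t ∈ Icc 0 T, s ≤ t → ω s t ≤ 1 → ∃ g' g'' : ℝ → ℝ,
      IsBoundedC2 (2 * M * ω s t ^ (1 / p)) (fun x => f x (X1 s t) + secondOrder f x (X2 s t))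
        g' g'' := by
    intro s hs t ht hst hW
    obtain ⟨h0, h1'⟩ := hε s hs t ht hst hW
    obtain ⟨S', S'', hS⟩ := second _ _ (h2 s hs t ht hst)
    have hF := first 0 (by norm_num) _ _ (h1 s hs t ht hst)
    simp only [iteratedDeriv_zero] at hF
    exact ⟨_, _, (hF.add hS).mono (by nlinarith [mul_nonneg hM0 h0])⟩
  have hmono : ∀ s ∈ Icc 0 T, ∀ u ∈ Icc 0 T, ∀ t ∈ Icc 0 T, s ≤ u → u ≤ t →
      ω s u ^ (1 / p) ≤ ω s t ^ (1 / p) ∧ ω u t ^ (1 / p) ≤ ω s t ^ (1 / p) := by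
    intro s hs u hu t ht hsu hut
    exact ⟨Real.rpow_le_rpow (hω.nonneg s hs u hu hsu) (hω.mono_right hs hu ht hsu hut)
        (by positivity),
      Real.rpow_le_rpow (hω.nonneg u hu t ht hut) (hω.mono_left hs hu ht hsu hut)
        (by positivity)⟩
  -- Chen's relation turns the cross term of `X2` into the product of `f' (X1 u t)` and `f (X1 s
  -- u)`, precisely the second order term subtracted in the defect estimates.
  have hdefect : ∀ s ∈ Icc 0 T, ∀ u ∈ Icc 0 T, ∀ t ∈ Icc 0 T, s ≤ u → u ≤ t → ∀ x,
      roughExpansion f X1 X2 u t (roughExpansion f X1 X2 s u x) - roughExpansion f X1 X2 s t x =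
      f (x + (f x (X1 s u) + secondOrder f x (X2 s u))) (X1 u t) - f x (X1 u t) +
      (secondOrder f (x + (f x (X1 s u) + secondOrder f x (X2 s u))) (X2 u t) -
        secondOrder f x (X2 u t)) - iteratedDeriv 1 f x (X1 u t) * f x (X1 s u) := by
    intro s hs u hu t ht hsu hut x
    have e1 := hX.chen_one s hs u hu t ht hsu hut
    have e2 := secondOrder_of_eq_mul (f := f) x (X1 s u) (X1 u t) (X2 s t - X2 s u - X2 u t)
      (fun i j => by
        simpa using hX.chen_two s hs u hu t ht hsu hut i j)
    have e3 : secondOrder f x (X2 s t) = secondOrder f x (X2 s u) + secondOrder f x (X2 u t) +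
        deriv f x (X1 u t) * f x (X1 s u) := by
      rw [← e2, ← secondOrder_add, ← secondOrder_add]
      congr 1; abel
    rw [iteratedDeriv_one, roughExpansion, roughExpansion, roughExpansion, e1, map_add, e3]
    ring
  have hle1 : ∀ s ∈ Icc 0 T, ∀ u ∈ Icc 0 T, ∀ t ∈ Icc 0 T, s ≤ u → u ≤ t →
      ‖X1 s u‖ ≤ ω s t ^ (1 / p) ∧ ‖X1 u t‖ ≤ ω s t ^ (1 / p) ∧
      ‖X2 s u‖ ≤ (ω s t ^ (1 / p)) ^ 2 ∧ ‖X2 u t‖ ≤ (ω s t ^ (1 / p)) ^ 2 := by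
    intro s hs u hu t ht hsu hut
    obtain ⟨ha, hb⟩ := hmono s hs u hu t ht hsu hut
    have h0 := Real.rpow_nonneg (hω.nonneg s hs u hu hsu) (1 / p)
    have h0' := Real.rpow_nonneg (hω.nonneg u hu t ht hut) (1 / p)
    exact ⟨(h1 s hs u hu hsu).trans ha, (h1 u hu t ht hut).trans hb,
      (h2 s hs u hu hsu).trans (by gcongr), (h2 u hu t ht hut).trans (by gcongr)⟩
  -- One constant for all four conditions: the first two need `2 * M`, the defect `4 * M ^ 3 + 3 * M
  -- ^ 2`, and its Lipschitz version `8 * M ^ 3 + 6 * M ^ 2`.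
  refine ⟨8 * M ^ 3 + 6 * M ^ 2 + 2 * M, by positivity, ?_, ?_, ?_, ?_⟩
  · intro s hs t ht hst hW x
    obtain ⟨g', g'', hg⟩ := hincr s hs t ht hst hW
    have := hg.bound x
    have h0 := (hε s hs t ht hst hW).1
    rw [roughExpansion, add_sub_cancel_left]
    exact this.trans (mul_le_mul_of_nonneg_right (le_add_of_nonneg_left (by positivity)) h0)
  · intro s hs t ht hst hW a b c d
    obtain ⟨g', g'', hg⟩ := hincr s hs t ht hst hW
    have := hg.second_diff a b c d
    have h0 := (hε s hs t ht hst hW).1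
    simp only [roughExpansion, add_sub_cancel_left]
    refine this.trans (mul_le_mul_of_nonneg_right (mul_le_mul_of_nonneg_right
      (le_add_of_nonneg_left (by positivity)) h0) (by positivity))
  · intro s hs u hu t ht hsu hut hW x
    rw [hdefect s hs u hu t ht hsu hut x]
    obtain ⟨hx1, hx2, hx3, hx4⟩ := hle1 s hs u hu t ht hsu hut
    obtain ⟨h0, h1'⟩ := hε s hs t ht (hsu.trans hut) hW
    obtain ⟨S', S'', hS⟩ := second _ _ hx3
    obtain ⟨R', R'', hR⟩ := second _ _ hx4
    have hα := first 0 (by norm_num) _ _ hx1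
    have hβ := first 0 (by norm_num) _ _ hx2
    simp only [iteratedDeriv_zero] at hα hβ
    have := abs_expansion_defect_le h0 h1' hα hS hβ hR hM0 x
    rw [← hcube s hs t ht (hsu.trans hut)]
    refine this.trans (mul_le_mul_of_nonneg_right ?_ (by positivity))
    nlinarith [pow_nonneg hM0 3, pow_nonneg hM0 2]
  · intro s hs u hu t ht hsu hut hW x y
    rw [hdefect s hs u hu t ht hsu hut x, hdefect s hs u hu t ht hsu hut y]
    obtain ⟨hx1, hx2, hx3, hx4⟩ := hle1 s hs u hu t ht hsu hut
    obtain ⟨h0, h1'⟩ := hε s hs t ht (hsu.trans hut) hW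
    obtain ⟨S', S'', hS⟩ := second _ _ hx3
    obtain ⟨R', R'', hR⟩ := second _ _ hx4
    have hα := first 0 (by norm_num) _ _ hx1
    have hβ := first 0 (by norm_num) _ _ hx2
    have hβ' := first 1 (by norm_num) _ _ hx2
    simp only [iteratedDeriv_zero] at hα hβ
    have := abs_expansion_defect_sub_le h0 h1' hα hS hβ hβ' hR hM0 x y
    rw [← hcube s hs t ht (hsu.trans hut)]
    refine this.trans (mul_le_mul_of_nonneg_right (mul_le_mul_of_nonneg_right ?_ (by positivity))
      (abs_nonneg _))
    linarith

/-! ### Variation norms and locally controlled remainders -/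

section Variation

variable {E : Type*} [NormedAddCommGroup E] {p : ℝ}

theorem pVar_mono {I J : Set ℝ} (hJ : J ⊆ I) (g : ℝ → ℝ → E) : pVar p J g ≤ pVar p I g :=
  iSup_mono fun n => iSup_le fun u =>
    le_iSup (fun u : {u : ℕ → ℝ // Monotone u ∧ ∀ i, u i ∈ I} =>
      ∑ i ∈ Finset.range n, ‖g (u.1 i) (u.1 (i + 1))‖ₑ ^ p) ⟨u.1, u.2.1, fun i => hJ (u.2.2 i)⟩

theorem enorm_rpow_le_pVar {s t : ℝ} (hst : s ≤ t) (g : ℝ → ℝ → E) :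
    ‖g s t‖ₑ ^ p ≤ pVar p (Icc s t) g := by
  have hmono : Monotone (fun i : ℕ => if i = 0 then s else t) := by
    refine monotone_nat_of_le_succ fun i => ?_
    by_cases hi : i = 0 <;> simp [hi, hst]
  have hmem : ∀ i : ℕ, (if i = 0 then s else t) ∈ Icc s t := by
    intro i
    by_cases hi : i = 0 <;> simp [hi, hst]
  refine le_trans ?_ (le_iSup₂ (f := fun (n : ℕ) (u : {u : ℕ → ℝ // Monotone u ∧
    ∀ i, u i ∈ Icc s t}) => ∑ i ∈ Finset.range n, ‖g (u.1 i) (u.1 (i + 1))‖ₑ ^ p) 1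
      ⟨_, hmono, hmem⟩)
  simp

theorem pVar_le_of_control {g : ℝ → ℝ → E} {ω : ℝ → ℝ → ℝ} {a b : ℝ} (hp : 0 ≤ p) (hab : a ≤ b)
    (hω : IsControl (Icc a b) ω)
    (hg : ∀ s ∈ Icc a b, ∀ t ∈ Icc a b, s ≤ t → ‖g s t‖ ^ p ≤ ω s t) :
    pVar p (Icc a b) g ≤ ENNReal.ofReal (ω a b) := by
  refine iSup₂_le fun n u => ?_
  obtain ⟨u, hu, hmem⟩ := u
  have h1 : ∑ i ∈ Finset.range n, ‖g (u i) (u (i + 1))‖ₑ ^ p ≤ ENNReal.ofReal (ω (u 0) (u n)) := by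
    induction n with
    | zero => simp
    | succ n ih =>
      rw [Finset.sum_range_succ]
      have h0 := hω.nonneg _ (hmem 0) _ (hmem n) (hu (Nat.zero_le n))
      have h0' := hω.nonneg _ (hmem n) _ (hmem (n + 1)) (hu n.le_succ)
      have h2 := hω.superadd _ (hmem 0) _ (hmem n) _ (hmem (n + 1)) (hu (Nat.zero_le n))
        (hu n.le_succ)
      have h3 := hg _ (hmem n) _ (hmem (n + 1)) (hu n.le_succ)
      refine (add_le_add ih ?_).trans
        ((ENNReal.ofReal_add h0 h0').symm.le.trans (ENNReal.ofReal_le_ofReal h2))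
      rw [← ofReal_norm, ENNReal.ofReal_rpow_of_nonneg (norm_nonneg _) hp]
      exact ENNReal.ofReal_le_ofReal h3
  refine h1.trans (ENNReal.ofReal_le_ofReal ?_)
  have ha : a ∈ Icc a b := left_mem_Icc.2 hab
  have hb : b ∈ Icc a b := right_mem_Icc.2 hab
  exact (hω.mono_right (hmem 0) (hmem n) hb (hu (Nat.zero_le n)) (hmem n).2).trans
    (hω.mono_left ha (hmem 0) hb (hmem 0).1 (hmem 0).2)

theorem memV1_of_control {g : ℝ → E} {ω : ℝ → ℝ → ℝ} {a b : ℝ} (hp : 0 ≤ p) (hab : a ≤ b)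
    (hω : IsControl (Icc a b) ω) (hr : IsRegular (Icc a b) ω)
    (hg : ∀ s ∈ Icc a b, ∀ t ∈ Icc a b, s ≤ t → ‖g t - g s‖ ^ p ≤ ω s t) :
    MemV1 p (Icc a b) g := by
  refine ⟨ne_top_of_le_ne_top ENNReal.ofReal_ne_top (pVar_le_of_control hp hab hω hg), ?_⟩
  intro ε hε
  obtain ⟨δ, hδ, H⟩ := hr ε hε
  refine ⟨δ, hδ, fun s hs t ht hst hd => lt_of_le_of_lt ?_ (H s hs t ht hst hd)⟩
  have hsub : Icc s t ⊆ Icc a b := Icc_subset_Icc hs.1 ht.2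
  rw [abs_of_nonneg ENNReal.toReal_nonneg, abs_of_nonneg (hω.nonneg s hs t ht hst)]
  refine ENNReal.toReal_le_of_le_ofReal (hω.nonneg s hs t ht hst) ?_
  exact pVar_le_of_control hp hst (hω.subset hsub)
    fun u hu v hv huv => hg u (hsub hu) v (hsub hv) huv

theorem MemV1.continuousOn {g : ℝ → ℝ} {a b : ℝ} (hp : 0 < p) (hg : MemV1 p (Icc a b) g) :
    ContinuousOn g (Icc a b) := by
  refine continuousOn_of_abs_sub_le (C := 1) (γ := 1 / p)
    (fun _ _ _ _ _ => ENNReal.toReal_nonneg) hg.2 zero_le_one (by positivity) ?_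
  intro s hs t ht hst
  have h1 := enorm_rpow_le_pVar (p := p) hst (incr g)
  have h2 : pVar p (Icc s t) (incr g) ≠ ∞ :=
    ne_top_of_le_ne_top hg.1 (pVar_mono (Icc_subset_Icc hs.1 ht.2) _)
  have h3 := ENNReal.toReal_mono h2 h1
  rw [← ENNReal.toReal_rpow, toReal_enorm] at h3
  rw [one_mul]
  calc |g t - g s| = (‖incr g s t‖ ^ p) ^ (1 / p) := by
        rw [← Real.rpow_mul (norm_nonneg _), mul_one_div_cancel hp.ne', Real.rpow_one]; rfl
    _ ≤ _ := Real.rpow_le_rpow (by positivity) h3 (by positivity)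

end Variation

/-- Off a countable set of left end points, a map in `V_{2,loc}` is controlled on a small interval
to the right. -/
theorem MemV2Loc.exists_right_control {q T : ℝ} {r : ℝ → ℝ → ℝ} (hr : MemV2Loc q (Icc 0 T) r) :
    ∃ K : Set ℝ, K.Countable ∧ ∀ u ∈ Ico 0 T, u ∉ K → ∃ b ∈ Ioc u T, ∃ ω : ℝ → ℝ → ℝ,
      IsControl (Icc u b) ω ∧ IsRegular (Icc u b) ω ∧
      ∀ s ∈ Icc u b, ∀ t ∈ Icc u b, s ≤ t → |r s t| ≤ ω s t ^ (1 / q) := by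
  obtain ⟨J, hJ, hcov, hV⟩ := hr
  -- A point of `J k` other than its greatest element has an interval to its right inside `J k`. The
  -- exceptional points are therefore among the suprema of the pieces.
  refine ⟨range fun k => sSup (J k), countable_range _, fun u hu huK => ?_⟩
  obtain ⟨k, hk⟩ := mem_iUnion.1 (hcov ⟨hu.1, hu.2.le⟩)
  obtain ⟨b, hb, hub⟩ : ∃ b ∈ J k, u < b := by
    by_contra! hcon
    exact huK ⟨k, (show IsGreatest (J k) u from ⟨hk, hcon⟩).csSup_eq⟩
  have hsub : Icc u b ⊆ J k := (hJ k).1.out hk hb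
  obtain ⟨ω, hω, hreg, hle⟩ := (hV k).2.2
  exact ⟨b, ⟨hub, ((hJ k).2 hb).2⟩, ω, hω.subset hsub, hreg.subset hsub,
    fun s hs t ht hst => hle s (hsub hs) t (hsub ht) hst⟩

/-! ### Uniqueness by transport to the terminal time -/

section Uniqueness

variable {d : ℕ} {p T : ℝ} {f : ℝ → Vec d →L[ℝ] ℝ} {X1 : ℝ → ℝ → Vec d} {X2 : ℝ → ℝ → Mat d}
  {y0 : ℝ} {y m z n : ℝ → ℝ} {ω : ℝ → ℝ → ℝ} {C L ε : ℝ} {φ : ℝ → ℝ → ℝ → ℝ}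

/-- The measure could charge time `0` only if the solution vanished there, which `0 < y0` excludes.
This fixes the additive constant of the reflection term. -/
theorem IsReflectedSolution.reflection_zero (h : IsReflectedSolution p T f X1 X2 y0 y m)
    (hT : 0 ≤ T) (hy0 : 0 < y0) : m 0 = 0 := by
  obtain ⟨μ, -, hμ⟩ := h.reflection
  rw [hμ 0 ⟨le_rfl, hT⟩]
  refine MeasureTheory.setIntegral_eq_zero_of_forall_eq_zero fun u hu => ?_
  have hu0 : u = 0 := le_antisymm hu.2 hu.1
  refine indicator_of_notMem ?_ _
  rw [mem_ofPred_eq, hu0, h.init]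
  exact hy0.ne'

/-- The reflection term is constant as long as the solution does not vanish. -/
theorem IsReflectedSolution.reflection_eq (h : IsReflectedSolution p T f X1 X2 y0 y m)
    {s t : ℝ} (hs : s ∈ Icc 0 T) (ht : t ∈ Icc 0 T) (hst : s ≤ t)
    (hy : ∀ u ∈ Ioc s t, y u ≠ 0) : m t = m s := by
  obtain ⟨μ, -, hμ⟩ := h.reflection
  rw [hμ t ht, hμ s hs]
  refine MeasureTheory.setIntegral_eq_of_subset_of_forall_sdiff_eq_zero measurableSet_Icc
    (Icc_subset_Icc_right hst) fun u hu => ?_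
  refine indicator_of_notMem (s := {u | y u = 0}) (fun hyu => hy u ⟨?_, hu.1.2⟩ hyu) _
  by_contra! hus
  exact hu.2 ⟨hu.1.1, hus⟩

theorem IsFlow.continuousOn_comp (hφ : IsFlow T ω (1 / p) (3 / p) C L ε (roughExpansion f X1 X2) φ)
    (hp : 0 < p) (hL : 1 ≤ L) (hC : 0 ≤ C) (hω : IsControl (Icc 0 T) ω)
    (hr : IsRegular (Icc 0 T) ω) (hT : 0 ≤ T) (hy : ContinuousOn y (Icc 0 T)) :
    ContinuousOn (fun t => φ t T (y t)) (Icc 0 T) := by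
  have hTT : T ∈ Icc 0 T := ⟨hT, le_rfl⟩
  -- the map `t ↦ φ t T x` is continuous, uniformly in `x`, and `φ t T` is equi-Lipschitz
  have hpt : ∀ x, ContinuousOn (fun t => φ t T x) (Icc 0 T) := by
    intro x
    refine continuousOn_of_abs_sub_le (C := L * C) hω.nonneg hr (by positivity)
      (show 0 < 1 / p by positivity) fun s hs t ht hst => ?_
    rw [← hφ.flow s hs t ht T hTT hst ht.2 x]
    refine (hφ.lipschitz hL ht hTT ht.2 _ _).trans ?_
    rw [mul_assoc, abs_sub_comm]
    exact mul_le_mul_of_nonneg_left (hφ.near_id s hs t ht hst x) (by linarith)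
  intro t ht
  have h1 : Tendsto (fun s => φ s T (y t)) (𝓝[Icc 0 T] t) (𝓝 (φ t T (y t))) := hpt (y t) t ht
  have h2 : Tendsto (fun s => L * |y s - y t|) (𝓝[Icc 0 T] t) (𝓝 0) := by
    have := (((hy t ht).tendsto).sub_const (y t)).abs.const_mul L
    simpa using this
  have h3 : Tendsto (fun s => φ s T (y s) - φ s T (y t)) (𝓝[Icc 0 T] t) (𝓝 0) := by
    refine squeeze_zero_norm' ?_ h2
    filter_upwards [self_mem_nhdsWithin] with s hs
    exact hφ.lipschitz hL hs hTT hs.2 _ _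
  have h4 := h3.add h1
  simp only [sub_add_cancel, zero_add] at h4
  exact h4

/-- Pushing a solution forward to time `T` along the flow gives a path which moves in the same
direction as the reflection term. -/
theorem IsReflectedSolution.pushforward_le (h : IsReflectedSolution p T f X1 X2 y0 y m)
    (hφ : IsFlow T ω (1 / p) (3 / p) C L ε (roughExpansion f X1 X2) φ)
    (hp : 0 < p) (hp3 : p < 3) (hL : 1 ≤ L) (hC : 0 ≤ C) (hε : 0 < ε)
    (hω : IsControl (Icc 0 T) ω) (hr : IsRegular (Icc 0 T) ω) {a b σ : ℝ} (hσ : σ = 1 ∨ σ = -1)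
    (ha : a ∈ Icc 0 T) (hb : b ∈ Icc 0 T) (hab : a ≤ b)
    (hm : ∀ s ∈ Icc a b, ∀ t ∈ Icc a b, s ≤ t → 0 ≤ σ * (m t - m s)) :
    σ * φ a T (y a) ≤ σ * φ b T (y b) := by
  have hT : 0 ≤ T := ha.1.trans ha.2
  have hTT : T ∈ Icc 0 T := ⟨hT, le_rfl⟩
  have hθ : 1 < 3 / p := by rwa [one_lt_div hp]
  obtain ⟨r, hrV, hdyn⟩ := h.dynamics
  obtain ⟨K, hK, hright⟩ := hrV.exists_right_control
  obtain ⟨δ, hδ, hδε⟩ := hr.exists_le hε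
  have hsubab : Icc a b ⊆ Icc 0 T := Icc_subset_Icc ha.1 hb.2
  refine le_of_eventually_ge_right_off_countable (g := fun t => σ * φ t T (y t)) hab
    (continuousOn_const.mul ((hφ.continuousOn_comp hp hL hC hω hr hT
      (h.y_mem.continuousOn hp)).mono hsubab)) hK fun u hu huK => ?_
  obtain ⟨c, hc, ω', hω', hr', hle⟩ := hright u ⟨ha.1.trans hu.1, hu.2.trans_le hb.2⟩ huK
  refine ⟨min c (u + δ), lt_min hc.1 (by linarith), fun w hw hwb => ?_⟩
  have hwc : w ≤ c := hw.2.le.trans (min_le_left _ _)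
  have hwδ : w < u + δ := hw.2.trans_le (min_le_right _ _)
  have hsub : Icc u w ⊆ Icc 0 T := Icc_subset_Icc (ha.1.trans hu.1) (hwb.trans hb.2)
  have hsub' : Icc u w ⊆ Icc u c := Icc_subset_Icc le_rfl hwc
  refine le_of_sub_ge_neg_rpow (g := fun t => σ * φ t T (y t)) (C := L * (C + 1)) (θ := 3 / p)
    hw.1.le ((hω.subset hsub).add (hω'.subset hsub')) ((hr.subset hsub).add (hr'.subset hsub'))
    (by positivity) hθ fun s hs t ht hst => ?_
  have hsT := hsub hs
  have htT := hsub ht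
  have hW : ω s t ≤ ε := hδε s hsT t htT hst (by linarith [hs.1, ht.2])
  have e1 := hdyn s hsT t htT hst
  have e2 := hle s (hsub' hs) t (hsub' ht) hst
  rw [show 1 / (p / 3) = 3 / p by field_simp] at e2
  have e3 := hφ.taylor s hsT t htT hst hW (y s)
  have e4 := hm s ⟨hu.1.trans hs.1, hs.2.trans hwb⟩ t ⟨hu.1.trans ht.1, ht.2.trans hwb⟩ hst
  have h0 := hω.nonneg s hsT t htT hst
  have h0' := hω'.nonneg s (hsub' hs) t (hsub' ht) hst
  set η := (C + 1) * (ω s t + ω' s t) ^ (3 / p) with hη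
  have hη0 : 0 ≤ η := by positivity
  have e5 : C * ω s t ^ (3 / p) + ω' s t ^ (3 / p) ≤ η := by
    have h5 : ω s t ^ (3 / p) ≤ (ω s t + ω' s t) ^ (3 / p) :=
      Real.rpow_le_rpow h0 (by linarith) (by positivity)
    have h6 : ω' s t ^ (3 / p) ≤ (ω s t + ω' s t) ^ (3 / p) :=
      Real.rpow_le_rpow h0' (by linarith) (by positivity)
    have := mul_le_mul_of_nonneg_left h5 hC
    rw [hη]; linarith
  -- The expansion of the dynamics and that of the flow cancel; only the reflection and errors of
  -- order `3/p` remain.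
  have e6 : |y t - φ s t (y s) - (m t - m s)| ≤ η := by
    simp only [incr] at e1
    rw [roughExpansion] at e3
    rw [abs_le] at *
    constructor <;> linarith [e2.1, e2.2, e3.1, e3.2]
  rw [← hφ.flow s hsT t htT T hTT hst htT.2 (y s), mul_assoc]
  have hmono := (hφ.strictMono hL htT hTT htT.2).monotone
  have hlip := hφ.lipschitz hL htT hTT htT.2 (y t) (φ s t (y s))
  have hLη : 0 ≤ L * η := by positivity
  have key : 0 ≤ σ * (y t - φ s t (y s)) → 0 ≤ σ * (φ t T (y t) - φ t T (φ s t (y s))) := by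
    rcases hσ with rfl | rfl
    · intro h
      have := hmono (show φ s t (y s) ≤ y t by linarith)
      linarith
    · intro h
      have := hmono (show y t ≤ φ s t (y s) by linarith)
      linarith
  -- If `y` has moved off the flow in the direction `σ`, order preservation suffices. Otherwise,
  -- since the reflection pushes towards `σ`, the whole deviation is error, at most `η`, and the
  -- Lipschitz bound of `φ t T` applies.
  rcases le_or_gt 0 (σ * (y t - φ s t (y s))) with hpos | hneg
  · have := key hpos
    nlinarith
  · have h7 : |y t - φ s t (y s)| ≤ η := by
      rcases hσ with rfl | rfl
      · rw [abs_le] at *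
        constructor <;> linarith [e6.1, e6.2]
      · rw [abs_le] at *
        constructor <;> linarith [e6.1, e6.2]
    have h8 := hlip.trans (mul_le_mul_of_nonneg_left h7 (by linarith))
    rw [abs_le] at h8
    rcases hσ with rfl | rfl <;> linarith [h8.1, h8.2]

/-- From the last zero `s` of `y` (or from `0`) up to `t`, `m` is constant while `n` is
nondecreasing. Hence `φ t T (y t) ≤ φ s T (y s) ≤ φ s T (z s) ≤ φ t T (z t)`, and strict
monotonicity of `φ t T` gives the claim. -/
theorem IsReflectedSolution.le_of_flow (h : IsReflectedSolution p T f X1 X2 y0 y m)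
    (h' : IsReflectedSolution p T f X1 X2 y0 z n)
    (hφ : IsFlow T ω (1 / p) (3 / p) C L ε (roughExpansion f X1 X2) φ)
    (hp : 0 < p) (hp3 : p < 3) (hL : 1 ≤ L) (hC : 0 ≤ C) (hε : 0 < ε)
    (hω : IsControl (Icc 0 T) ω) (hr : IsRegular (Icc 0 T) ω) {t : ℝ} (ht : t ∈ Icc 0 T) :
    y t ≤ z t := by
  have hTT : T ∈ Icc 0 T := ⟨ht.1.trans ht.2, le_rfl⟩
  obtain ⟨s, hs, hys, hpos⟩ : ∃ s ∈ Icc 0 t, y s ≤ z s ∧ ∀ u ∈ Ioc s t, y u ≠ 0 := by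
    set S := Icc 0 t ∩ y ⁻¹' {0} with hS
    have hclosed : IsClosed S := ((h.y_mem.continuousOn hp).mono
      (Icc_subset_Icc_right ht.2)).preimage_isClosed_of_isClosed isClosed_Icc isClosed_singleton
    have hbdd : BddAbove S := ⟨t, fun x hx => hx.1.2⟩
    rcases S.eq_empty_or_nonempty with hSe | hSne
    · refine ⟨0, ⟨le_rfl, ht.1⟩, by rw [h.init, h'.init], fun u hu hyu => ?_⟩
      have : u ∈ S := ⟨⟨hu.1.le, hu.2⟩, hyu⟩
      rw [hSe] at this
      exact this
    · have hmem := hclosed.csSup_mem hSne hbdd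
      refine ⟨sSup S, hmem.1, ?_, fun u hu hyu => ?_⟩
      · rw [show y (sSup S) = 0 from hmem.2]
        exact h'.y_nonneg _ ⟨hmem.1.1, hmem.1.2.trans ht.2⟩
      · exact absurd (le_csSup hbdd (show u ∈ S from ⟨⟨hmem.1.1.trans hu.1.le, hu.2⟩, hyu⟩))
          (not_le.2 hu.1)
  have hsT : s ∈ Icc 0 T := ⟨hs.1, hs.2.trans ht.2⟩
  have e1 := h.pushforward_le hφ hp hp3 hL hC hε hω hr (σ := -1) (Or.inr rfl) hsT ht hs.2 (by
    intro u hu v hv huv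
    have hu' : u ∈ Icc 0 T := ⟨hs.1.trans hu.1, hu.2.trans ht.2⟩
    have hv' : v ∈ Icc 0 T := ⟨hs.1.trans hv.1, hv.2.trans ht.2⟩
    rw [h.reflection_eq hu' hv' huv fun x hx =>
      hpos x ⟨hu.1.trans_lt hx.1, hx.2.trans hv.2⟩]
    simp)
  have e2 := h'.pushforward_le hφ hp hp3 hL hC hε hω hr (σ := 1) (Or.inl rfl) hsT ht hs.2 (by
    intro u hu v hv huv
    rw [one_mul, sub_nonneg]
    exact h'.m_mono ⟨hs.1.trans hu.1, hu.2.trans ht.2⟩ ⟨hs.1.trans hv.1, hv.2.trans ht.2⟩ huv)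
  have e3 := (hφ.strictMono hL hsT hTT hsT.2).monotone hys
  exact (hφ.strictMono hL ht hTT ht.2).le_iff_le.1 (by linarith)

/-- The reflection term is determined by the solution. -/
theorem IsReflectedSolution.reflection_le (h : IsReflectedSolution p T f X1 X2 y0 y m)
    (h' : IsReflectedSolution p T f X1 X2 y0 z n) (hp : 0 < p) (hp3 : p < 3) (hy0 : 0 < y0)
    (hyz : EqOn y z (Icc 0 T)) {t : ℝ} (ht : t ∈ Icc 0 T) : m t ≤ n t := by
  have hT : 0 ≤ T := ht.1.trans ht.2
  have hθ : 1 < 3 / p := by rwa [one_lt_div hp]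
  have hexp : 1 / (p / 3) = 3 / p := by field_simp
  obtain ⟨r, hrV, hdyn⟩ := h.dynamics
  obtain ⟨r', hrV', hdyn'⟩ := h'.dynamics
  obtain ⟨K, hK, hright⟩ := hrV.exists_right_control
  obtain ⟨K', hK', hright'⟩ := hrV'.exists_right_control
  have hsubt : Icc 0 t ⊆ Icc 0 T := Icc_subset_Icc_right ht.2
  -- Since `y = z`, the increments of `n - m` are differences of the two remainders. Off both
  -- exceptional sets they are locally of order `3/p > 1` in a control.
  have := le_of_eventually_ge_right_off_countable (g := fun t => n t - m t) ht.1
    (((h'.m_mem.continuousOn one_pos).sub (h.m_mem.continuousOn one_pos)).mono hsubt)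
    (hK.union hK') fun u hu huK => ?_
  · rw [h.reflection_zero hT hy0, h'.reflection_zero hT hy0] at this
    linarith
  rw [mem_union, not_or] at huK
  obtain ⟨c, hc, ω, hω, hr, hle⟩ := hright u ⟨hu.1, hu.2.trans_le ht.2⟩ huK.1
  obtain ⟨c', hc', ω', hω', hr', hle'⟩ := hright' u ⟨hu.1, hu.2.trans_le ht.2⟩ huK.2
  refine ⟨min c c', lt_min hc.1 hc'.1, fun w hw hwt => ?_⟩
  have hsub : Icc u w ⊆ Icc u c := Icc_subset_Icc le_rfl (hw.2.le.trans (min_le_left _ _))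
  have hsub' : Icc u w ⊆ Icc u c' := Icc_subset_Icc le_rfl (hw.2.le.trans (min_le_right _ _))
  have hsubT : Icc u w ⊆ Icc 0 T := Icc_subset_Icc hu.1 (hwt.trans ht.2)
  refine le_of_sub_ge_neg_rpow (g := fun t => n t - m t) (C := 2) (θ := 3 / p)
    hw.1.le ((hω.subset hsub).add (hω'.subset hsub')) ((hr.subset hsub).add (hr'.subset hsub'))
    (by positivity) hθ fun s hs v hv hsv => ?_
  have e1 := hdyn s (hsubT hs) v (hsubT hv) hsv
  have e2 := hdyn' s (hsubT hs) v (hsubT hv) hsv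
  have e3 := hle s (hsub hs) v (hsub hv) hsv
  have e4 := hle' s (hsub' hs) v (hsub' hv) hsv
  have h0 := hω.nonneg s (hsub hs) v (hsub hv) hsv
  have h0' := hω'.nonneg s (hsub' hs) v (hsub' hv) hsv
  have h5 : ω s v ^ (3 / p) ≤ (ω s v + ω' s v) ^ (3 / p) :=
    Real.rpow_le_rpow h0 (by linarith) (by positivity)
  have h6 : ω' s v ^ (3 / p) ≤ (ω s v + ω' s v) ^ (3 / p) :=
    Real.rpow_le_rpow h0' (by linarith) (by positivity)
  rw [hexp] at e3 e4
  simp only [incr, ← hyz (hsubT hs), ← hyz (hsubT hv)] at e1 e2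
  rw [abs_le] at e3 e4
  linarith [e3.1, e3.2, e4.1, e4.2]

end Uniqueness

/-! ### One-sided limits -/

section OneSidedLimits

variable {E F : Type*} [NormedAddCommGroup E] [NormedAddCommGroup F] {S : Set ℝ}

theorem HasOneSidedLimits.mono {S' : Set ℝ} {h : ℝ → E} (H : HasOneSidedLimits S h)
    (hS : S' ⊆ S) : HasOneSidedLimits S' h := by
  intro x hx
  obtain ⟨⟨l, hl⟩, r, hr⟩ := H x (hS hx)
  exact ⟨⟨l, hl.mono_left (nhdsWithin_mono _ (inter_subset_inter_left _ hS))⟩,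
    r, hr.mono_left (nhdsWithin_mono _ (inter_subset_inter_left _ hS))⟩

theorem _root_.ContinuousOn.hasOneSidedLimits {h : ℝ → E} (H : ContinuousOn h S) :
    HasOneSidedLimits S h := fun x hx =>
  ⟨⟨_, (H x hx).mono_left (nhdsWithin_mono _ inter_subset_left)⟩,
    _, (H x hx).mono_left (nhdsWithin_mono _ inter_subset_left)⟩

theorem HasOneSidedLimits.prodMk {h : ℝ → E} {k : ℝ → F} (H : HasOneSidedLimits S h)
    (H' : HasOneSidedLimits S k) : HasOneSidedLimits S (fun x => (h x, k x)) := by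
  intro x hx
  obtain ⟨⟨l, hl⟩, r, hr⟩ := H x hx
  obtain ⟨⟨l', hl'⟩, r', hr'⟩ := H' x hx
  exact ⟨⟨_, hl.prodMk_nhds hl'⟩, _, hr.prodMk_nhds hr'⟩

theorem HasOneSidedLimits.comp {h : ℝ → E} {G : E → F} (H : HasOneSidedLimits S h)
    (hG : Continuous G) : HasOneSidedLimits S (fun x => G (h x)) := by
  intro x hx
  obtain ⟨⟨l, hl⟩, r, hr⟩ := H x hx
  exact ⟨⟨_, (hG.tendsto l).comp hl⟩, _, (hG.tendsto r).comp hr⟩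

end OneSidedLimits

/-! ### Tools for existence: running maximum, additive sewing, reflection measure -/

/-- The running maximum of a continuous function. -/
theorem exists_running_max {T D γ c : ℝ} {ω : ℝ → ℝ → ℝ} {h : ℝ → ℝ}
    (hω : IsControl (Icc 0 T) ω) (hr : IsRegular (Icc 0 T) ω) (hT : 0 ≤ T) (hD : 0 ≤ D) (hγ : 0 < γ)
    (hh : ∀ s ∈ Icc 0 T, ∀ t ∈ Icc 0 T, s ≤ t → |h t - h s| ≤ D * ω s t ^ γ) :
    ∃ v : ℝ → ℝ, MonotoneOn v (Icc 0 T) ∧ v 0 = max c (h 0) ∧ (∀ t ∈ Icc 0 T, h t ≤ v t) ∧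
      (∀ s ∈ Icc 0 T, ∀ t ∈ Icc 0 T, s ≤ t → v t - v s ≤ D * ω s t ^ γ) ∧
      ∀ s ∈ Icc 0 T, ∀ t ∈ Icc 0 T, s ≤ t → (∀ u ∈ Icc s t, h u < v u) → v t = v s := by
  have hc : ContinuousOn h (Icc 0 T) := continuousOn_of_abs_sub_le hω.nonneg hr hD hγ hh
  have hmax : ∀ t ∈ Icc 0 T, ∃ x ∈ Icc 0 t, IsMaxOn h (Icc 0 t) x := fun t ht =>
    isCompact_Icc.exists_isMaxOn ⟨0, left_mem_Icc.2 ht.1⟩ (hc.mono (Icc_subset_Icc_right ht.2))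
  choose! a ha hamax using hmax
  have hmono : MonotoneOn (fun t => max c (h (a t))) (Icc 0 T) := by
    intro s hs t ht hst
    exact max_le_max le_rfl (hamax t ht ⟨(ha s hs).1, (ha s hs).2.trans hst⟩)
  have hhv : ∀ t ∈ Icc 0 T, ∀ s ∈ Icc 0 t, h s ≤ max c (h (a t)) := fun t ht s hs =>
    (hamax t ht hs).trans (le_max_right _ _)
  refine ⟨fun t => max c (h (a t)), hmono, ?_, ?_, ?_, ?_⟩
  · have := ha 0 ⟨le_rfl, hT⟩
    have h1 : a 0 = 0 := le_antisymm this.2 this.1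
    simp only [h1]
  · exact fun t ht => hhv t ht t ⟨ht.1, le_rfl⟩
  · intro s hs t ht hst
    have hp : 0 ≤ D * ω s t ^ γ := mul_nonneg hD (Real.rpow_nonneg (hω.nonneg s hs t ht hst) γ)
    rw [sub_le_iff_le_add']
    refine max_le ((le_max_left _ _).trans (le_add_of_nonneg_right hp)) ?_
    rcases le_total (a t) s with hle | hle
    · exact (hhv s hs _ ⟨(ha t ht).1, hle⟩).trans (le_add_of_nonneg_right hp)
    · have hat : a t ∈ Icc 0 T := ⟨(ha t ht).1, (ha t ht).2.trans ht.2⟩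
      have h1 := (abs_le.1 (hh s hs _ hat hle)).2
      have h2 := hhv s hs s ⟨hs.1, le_rfl⟩
      have h3 : D * ω s (a t) ^ γ ≤ D * ω s t ^ γ := mul_le_mul_of_nonneg_left
        (Real.rpow_le_rpow (hω.nonneg s hs _ hat hle)
          (hω.mono_right hs hat ht hle (ha t ht).2) hγ.le) hD
      linarith
  · intro s hs t ht hst hlt
    refine le_antisymm (max_le (le_max_left _ _) ?_) (hmono hs ht hst)
    rcases le_total (a t) s with hle | hle
    · exact hhv s hs _ ⟨(ha t ht).1, hle⟩
    -- If the maximiser `a t` lies in `[s, t]`, then `h (a t) < v (a t) ≤ max c (h (a t))`. So the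
    -- maximum is `c`, which `v s` already dominates.
    · have hat : a t ∈ Icc 0 T := ⟨(ha t ht).1, (ha t ht).2.trans ht.2⟩
      have h1 := hlt _ ⟨hle, (ha t ht).2⟩
      have h2 : max c (h (a (a t))) ≤ max c (h (a t)) := hmono hat ht (ha t ht).2
      have h3 := h1.trans_le h2
      rcases lt_max_iff.1 h3 with h4 | h4
      · exact h4.le.trans (le_max_left _ _)
      · exact absurd h4 (lt_irrefl _)

/-- The additive sewing lemma. -/
theorem exists_additive_sewing {T θ K R : ℝ} {ω : ℝ → ℝ → ℝ} {a : ℝ → ℝ → ℝ}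
    (hω : IsControl (Icc 0 T) ω) (hr : IsRegular (Icc 0 T) ω) (hT : 0 ≤ T)
    (hθ : 1 < θ) (hK : 0 ≤ K) (hR : 0 < R)
    (ha : ∀ s ∈ Icc 0 T, ∀ t ∈ Icc 0 T, s ≤ t → |a s t| ≤ K * ω s t)
    (hδa : ∀ s ∈ Icc 0 T, ∀ u ∈ Icc 0 T, ∀ t ∈ Icc 0 T, s ≤ u → u ≤ t → ω s t ≤ R →
      |a s u + a u t - a s t| ≤ K * ω s t ^ θ) :
    ∃ m : ℝ → ℝ, ∃ ε > 0, ε ≤ R ∧ ε ≤ 1 ∧ ∃ C ≥ 0, m 0 = 0 ∧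
      ∀ s ∈ Icc 0 T, ∀ t ∈ Icc 0 T, s ≤ t → ω s t ≤ ε →
        |m t - m s - a s t| ≤ C * ω s t ^ θ := by
  -- Additive sewing is nonlinear sewing of translations, whose second differences vanish. The sewn
  -- function is the trajectory of `0`.
  have happ : IsApproxFlow (Icc 0 T) ω 1 θ K R (fun s t x => x + a s t) := by
    refine ⟨fun s hs t ht hst _ x => ?_, fun s hs t ht hst _ x y z w => ?_,
      fun s hs u hu t ht hsu hut hW x => ?_, fun s hs u hu t ht hsu hut hW x y => ?_⟩
    · rw [Real.rpow_one, add_sub_cancel_left]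
      exact ha s hs t ht hst
    · have h0 := hω.nonneg s hs t ht hst
      simp only [add_sub_cancel_left]
      rw [show a s t - a s t - a s t + a s t = 0 by ring, abs_zero]
      positivity
    · have := hδa s hs u hu t ht hsu hut hW
      rwa [show x + a s u + a u t - (x + a s t) = a s u + a u t - a s t by ring]
    · have h0 := hω.nonneg s hs t ht (hsu.trans hut)
      rw [show x + a s u + a u t - (x + a s t) - (y + a s u + a u t - (y + a s t)) = 0 by ring,
        abs_zero]
      positivity
  obtain ⟨ψ, ε, hε, hεR, hε1, C, hC, hflow, hnear, -⟩ :=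
    happ.exists_flow hω hr one_pos hθ hK hR
  have h0T : (0 : ℝ) ∈ Icc 0 T := ⟨le_rfl, hT⟩
  refine ⟨fun t => ψ 0 t 0, ε, hε, hεR, hε1, C, hC, ?_, ?_⟩
  · have h00 := hω.self_eq_zero h0T
    have h1 := hnear 0 h0T 0 h0T le_rfl (by rw [h00]; exact hε.le) 0
    have h2 := ha 0 h0T 0 h0T le_rfl
    rw [h00, mul_zero, abs_nonpos_iff] at h2
    rw [h00, h2, Real.zero_rpow (by linarith), mul_zero, abs_nonpos_iff] at h1
    simpa using h1
  · intro s hs t ht hst hW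
    have := hnear s hs t ht hst hW (ψ 0 s 0)
    rw [hflow 0 h0T s hs t ht hs.1 hst] at this
    rwa [sub_sub]

/-- A continuous nondecreasing function which is constant wherever `y` does not vanish is a
reflection term for `y`. -/
theorem isReflectionTerm_of_monotoneOn {T : ℝ} {y m : ℝ → ℝ} (hT : 0 ≤ T)
    (hm : MonotoneOn m (Icc 0 T)) (hmc : ContinuousOn m (Icc 0 T)) (hm0 : m 0 = 0)
    (hy : ContinuousOn y (Icc 0 T))
    (hconst : ∀ s ∈ Icc 0 T, ∀ t ∈ Icc 0 T, s ≤ t → (∀ u ∈ Icc s t, y u ≠ 0) → m t = m s) :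
    IsReflectionTerm T y m := by
  -- Extending `m` by constants outside `[0, T]` gives a continuous Stieltjes function; its measure
  -- has no atoms, so closed intervals have the expected mass.
  set M : ℝ → ℝ := IccExtend hT (fun x : Icc 0 T => m x) with hM
  have hMmono : Monotone M := Monotone.IccExtend hT fun x y hxy => hm x.2 y.2 hxy
  have hMcont : Continuous M := (continuousOn_iff_continuous_domRestrict.1 hmc).Icc_extend'
  have hMeq : ∀ t ∈ Icc 0 T, M t = m t := fun t ht => IccExtend_of_mem hT _ ht
  let S : StieltjesFunction ℝ := ⟨M, hMmono, fun x => hMcont.continuousWithinAt⟩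
  have hSIcc : ∀ a b, S.measure (Icc a b) = ENNReal.ofReal (M b - M a) := by
    intro a b
    rw [S.measure_Icc]
    congr 2
    exact ContinuousWithinAt.leftLim_eq hMcont.continuousWithinAt
  have hS0 : ∀ t ∈ Icc 0 T, S.measure (Icc 0 t) = ENNReal.ofReal (m t) := by
    intro t ht
    rw [hSIcc, hMeq t ht, hMeq 0 ⟨le_rfl, hT⟩, hm0, sub_zero]
  refine ⟨S.measure, hS0, fun t ht => ?_⟩
  -- Near a point where `y` does not vanish `m` is constant, so the set of such points is locally
  -- null, hence null.
  have hnull : S.measure {u | u ∈ Icc 0 t ∧ y u ≠ 0} = 0 := by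
    refine MeasureTheory.measure_null_of_locally_null _ fun x hx => ?_
    have hxT : x ∈ Icc 0 T := ⟨hx.1.1, hx.1.2.trans ht.2⟩
    have hev : ∀ᶠ u in 𝓝[Icc 0 T] x, y u ≠ 0 := (hy x hxT).eventually_ne hx.2
    obtain ⟨η, hη, hball⟩ := Metric.mem_nhdsWithin_iff.1 hev
    refine ⟨Icc (max 0 (x - η / 2)) (min T (x + η / 2)), ?_, ?_⟩
    · have h1 : Icc (x - η / 2) (x + η / 2) ∈ 𝓝 x :=
        Icc_mem_nhds (by linarith) (by linarith)
      filter_upwards [nhdsWithin_le_nhds h1, self_mem_nhdsWithin] with u hu hu'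
      exact ⟨max_le hu'.1.1 hu.1, le_min (hu'.1.2.trans ht.2) hu.2⟩
    · rw [hSIcc]
      have ha : max 0 (x - η / 2) ∈ Icc 0 T :=
        ⟨le_max_left _ _, max_le hT (by linarith [hxT.2])⟩
      have hb : min T (x + η / 2) ∈ Icc 0 T :=
        ⟨le_min hT (by linarith [hxT.1]), min_le_left _ _⟩
      have hab : max 0 (x - η / 2) ≤ min T (x + η / 2) :=
        (max_le hxT.1 (by linarith)).trans (le_min hxT.2 (by linarith : x ≤ x + η / 2))
      rw [hMeq _ ha, hMeq _ hb, hconst _ ha _ hb hab, sub_self, ENNReal.ofReal_zero]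
      intro u hu
      have h1 := (le_max_right 0 (x - η / 2)).trans hu.1
      have h2 := hu.2.trans (min_le_right T (x + η / 2))
      refine hball ⟨?_, ha.1.trans hu.1, hu.2.trans hb.2⟩
      rw [Metric.mem_ball, Real.dist_eq, abs_lt]
      constructor <;> linarith
  have hae : ∀ᵐ u ∂S.measure, u ∈ Icc 0 t →
      {u | y u = 0}.indicator (fun _ => (1 : ℝ)) u = 1 := by
    have : ∀ᵐ u ∂S.measure, ¬ (u ∈ Icc 0 t ∧ y u ≠ 0) := by
      rw [MeasureTheory.ae_iff]
      simpa [and_assoc] using hnull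
    filter_upwards [this] with u hu hut
    have : y u = 0 := by
      by_contra hne
      exact hu ⟨hut, hne⟩
    exact indicator_of_mem (s := {u | y u = 0}) this _
  rw [MeasureTheory.setIntegral_congr_ae measurableSet_Icc hae]
  have hmt : 0 ≤ m t := hm0 ▸ hm ⟨le_rfl, hT⟩ ht ht.1
  rw [MeasureTheory.setIntegral_const, smul_eq_mul, mul_one, MeasureTheory.measureReal_def,
    hS0 t ht, ENNReal.toReal_ofReal hmt]

theorem continuous_secondOrder {d : ℕ} {f : ℝ → Vec d →L[ℝ] ℝ} (hf : Continuous f)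
    (hf' : Continuous (deriv f)) :
    Continuous fun z : ℝ × Mat d => secondOrder f z.1 z.2 := by
  unfold secondOrder
  fun_prop

/-- Remainders of rough expansions have one-sided limits. -/
theorem hasOneSidedLimits_remainder {d : ℕ} {f : ℝ → Vec d →L[ℝ] ℝ} (hf : Continuous f)
    (hf' : Continuous (deriv f)) {S : Set ℝ} {u v w : ℝ → ℝ} {x1 : ℝ → Vec d} {x2 : ℝ → Mat d}
    (hu : HasOneSidedLimits S u) (hv : HasOneSidedLimits S v) (hw : HasOneSidedLimits S w)
    (hx1 : HasOneSidedLimits S x1) (hx2 : HasOneSidedLimits S x2) :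
    HasOneSidedLimits S fun t => u t - (f (v t) (x1 t) + secondOrder f (v t) (x2 t)) - w t := by
  have hF : Continuous fun z : ℝ × Vec d => f z.1 z.2 := by fun_prop
  have h1 : HasOneSidedLimits S fun t => f (v t) (x1 t) := (hv.prodMk hx1).comp hF
  have h2 : HasOneSidedLimits S fun t => secondOrder f (v t) (x2 t) :=
    (hv.prodMk hx2).comp (continuous_secondOrder hf hf')
  have h3 : HasOneSidedLimits S fun t => f (v t) (x1 t) + secondOrder f (v t) (x2 t) :=
    (h1.prodMk h2).comp (continuous_fst.add continuous_snd)
  have h4 : HasOneSidedLimits S fun t => u t - (f (v t) (x1 t) + secondOrder f (v t) (x2 t)) :=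
    (hu.prodMk h3).comp (continuous_fst.sub continuous_snd)
  exact (h4.prodMk hw).comp (continuous_fst.sub continuous_snd)

/-! ### Existence of reflected solutions -/

/-- Existence of reflected solutions, given the flow of the equation without reflection. -/
theorem IsFlow.exists_isReflectedSolution {d : ℕ} {p T : ℝ} {f : ℝ → Vec d →L[ℝ] ℝ}
    {X1 : ℝ → ℝ → Vec d} {X2 : ℝ → ℝ → Mat d} {y0 : ℝ} {ω : ℝ → ℝ → ℝ} {C L ε : ℝ}
    {φ : ℝ → ℝ → ℝ → ℝ}
    (hφ : IsFlow T ω (1 / p) (3 / p) C L ε (roughExpansion f X1 X2) φ)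
    (hX : IsRoughPath p T X1 X2) (hf : Continuous f) (hf' : Continuous (deriv f))
    (hp2 : 2 ≤ p) (hp3 : p < 3) (hL : 1 ≤ L) (hC : 0 ≤ C) (hε : 0 < ε) (hε1 : ε ≤ 1)
    (hω : IsControl (Icc 0 T) ω) (hr : IsRegular (Icc 0 T) ω) (hT : 0 ≤ T) (hy0 : 0 < y0) :
    ∃ y m : ℝ → ℝ, IsReflectedSolution p T f X1 X2 y0 y m := by
  have hp : 0 < p := by linarith
  have hγ : 0 < 1 / p := by positivity
  have hθ : 1 < 3 / p := by rwa [one_lt_div hp]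
  have hθ2 : 3 / p ≤ 1 / p + 1 := by
    rw [div_add_one hp.ne']
    exact div_le_div_of_nonneg_right (by linarith) hp.le
  have h0T : (0 : ℝ) ∈ Icc 0 T := ⟨le_rfl, hT⟩
  have hTT : T ∈ Icc 0 T := ⟨hT, le_rfl⟩
  have hsm : ∀ t ∈ Icc 0 T, StrictMono (φ t T) := fun t ht => hφ.strictMono hL ht hTT ht.2
  -- the boundary, transported to time `T`, and its running maximum
  have hh : ∀ s ∈ Icc 0 T, ∀ t ∈ Icc 0 T, s ≤ t →
      |φ t T 0 - φ s T 0| ≤ (L * C) * ω s t ^ (1 / p) := by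
    intro s hs t ht hst
    rw [← hφ.flow s hs t ht T hTT hst ht.2 0, mul_assoc]
    refine (hφ.lipschitz hL ht hTT ht.2 _ _).trans ?_
    rw [abs_sub_comm]
    exact mul_le_mul_of_nonneg_left (hφ.near_id s hs t ht hst 0) (by linarith)
  have hLC : 0 ≤ L * C := by positivity
  obtain ⟨v, hvmono, hv0, hhv, hvω, hvconst⟩ :=
    exists_running_max (c := φ 0 T y0) hω hr hT hLC hγ hh
  have hvcont : ContinuousOn v (Icc 0 T) := by
    refine continuousOn_of_abs_sub_le hω.nonneg hr hLC hγ fun s hs t ht hst => ?_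
    rw [abs_of_nonneg (sub_nonneg.2 (hvmono hs ht hst))]
    exact hvω s hs t ht hst
  -- the solution
  have hysurj : ∀ t ∈ Icc 0 T, ∃ x, φ t T x = v t := fun t ht =>
    hφ.surjective hL ht hTT ht.2 (v t)
  choose! y hy using hysurj
  have hy_nonneg : ∀ t ∈ Icc 0 T, 0 ≤ y t := fun t ht =>
    (hsm t ht).le_iff_le.1 (by rw [hy t ht]; exact hhv t ht)
  have hy_init : y 0 = y0 := by
    refine (hsm 0 h0T).injective ?_
    rw [hy 0 h0T, hv0]
    exact max_eq_left ((hsm 0 h0T).monotone hy0.le)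
  -- The gap between `y` and the unreflected flow started from `y s`: to leading order the push of
  -- the boundary over `[s, t]`. After transport to time `T` it is exactly `v t - v s`, hence its
  -- sign and its bound.
  set a : ℝ → ℝ → ℝ := fun s t => y t - φ s t (y s) with ha_def
  have ha : ∀ s ∈ Icc 0 T, ∀ t ∈ Icc 0 T, s ≤ t → 0 ≤ a s t ∧ a s t ≤ L * (v t - v s) := by
    intro s hs t ht hst
    have h1 : φ t T (y t) - φ t T (φ s t (y s)) = v t - v s := by
      rw [hφ.flow s hs t ht T hTT hst ht.2, hy s hs, hy t ht]
    have h2 : φ s t (y s) ≤ y t := by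
      refine (hsm t ht).le_iff_le.1 (sub_nonneg.1 ?_)
      rw [h1]
      exact sub_nonneg.2 (hvmono hs ht hst)
    have h3 := (hφ.bilipschitz t ht T hTT ht.2 _ _ h2).1
    rw [h1, inv_mul_le_iff₀ (by linarith)] at h3
    exact ⟨sub_nonneg.2 h2, h3⟩
  have hyω : ∀ s ∈ Icc 0 T, ∀ t ∈ Icc 0 T, s ≤ t →
      |y t - y s| ≤ (L * (L * C) + C) * ω s t ^ (1 / p) := by
    intro s hs t ht hst
    have h1 := ha s hs t ht hst
    have h2 := hvω s hs t ht hst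
    have h3 := hφ.near_id s hs t ht hst (y s)
    have h4 : a s t ≤ L * ((L * C) * ω s t ^ (1 / p)) :=
      h1.2.trans (mul_le_mul_of_nonneg_left h2 (by linarith))
    rw [show y t - y s = a s t + (φ s t (y s) - y s) by simp only [ha_def]; ring]
    refine (abs_add_le _ _).trans ?_
    rw [abs_of_nonneg h1.1]
    linarith
  have hD : 0 ≤ L * (L * C) + C := by positivity
  have hy_mem : MemV1 p (Icc 0 T) y := by
    refine memV1_of_control hp.le hT (hω.const_mul (Real.rpow_nonneg hD p))
      (hr.const_mul (Real.rpow_nonneg hD p)) fun s hs t ht hst => ?_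
    have h0 := hω.nonneg s hs t ht hst
    calc ‖y t - y s‖ ^ p ≤ ((L * (L * C) + C) * ω s t ^ (1 / p)) ^ p :=
          Real.rpow_le_rpow (norm_nonneg _) (hyω s hs t ht hst) hp.le
      _ = _ := by
          rw [Real.mul_rpow hD (Real.rpow_nonneg h0 _), ← Real.rpow_mul h0,
            one_div_mul_cancel hp.ne', Real.rpow_one]
  have hycont := hy_mem.continuousOn hp
  -- the reflection term
  set w : ℝ → ℝ → ℝ := fun s t => ω s t + (v t - v s) with hw_def
  have hw : IsControl (Icc 0 T) w := hω.add (isControl_of_monotoneOn hvmono)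
  have hwr : IsRegular (Icc 0 T) w := hr.add (isRegular_of_continuousOn hvcont)
  have hωw : ∀ s ∈ Icc 0 T, ∀ t ∈ Icc 0 T, s ≤ t → ω s t ≤ w s t := fun s hs t ht hst =>
    le_add_of_nonneg_right (sub_nonneg.2 (hvmono hs ht hst))
  have hvw : ∀ s ∈ Icc 0 T, ∀ t ∈ Icc 0 T, s ≤ t → v t - v s ≤ w s t := fun s hs t ht hst =>
    le_add_of_nonneg_left (hω.nonneg s hs t ht hst)
  -- The defect of `a` is the difference of the displacements `φ u t x - x` at two points `a s u`
  -- apart. It is at most `C * ω ^ (1/p) * a s u`, and `a s u` is linear in `w`; this gives order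
  -- `1/p + 1 ≥ 3/p`.
  have hδa : ∀ s ∈ Icc 0 T, ∀ u ∈ Icc 0 T, ∀ t ∈ Icc 0 T, s ≤ u → u ≤ t → w s t ≤ ε →
      |a s u + a u t - a s t| ≤ (L + C * L) * w s t ^ (3 / p) := by
    intro s hs u hu t ht hsu hut hW
    have hst := hsu.trans hut
    have hw0 := hw.nonneg s hs t ht hst
    have h1 := hφ.near_id_lipschitz u hu t ht hut
      ((hωw u hu t ht hut).trans ((hw.mono_left hs hu ht hsu hut).trans hW)) (φ s u (y s)) (y u)
    rw [hφ.flow s hs u hu t ht hsu hut] at h1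
    have h2 := ha s hs u hu hsu
    rw [show |φ s u (y s) - y u| = a s u by
      rw [abs_sub_comm]; exact abs_of_nonneg h2.1] at h1
    rw [show a s u + a u t - a s t = φ s t (y s) - φ s u (y s) - (φ u t (y u) - y u) by
      simp only [ha_def]; ring]
    have h3 : ω u t ^ (1 / p) ≤ w s t ^ (1 / p) := Real.rpow_le_rpow (hω.nonneg u hu t ht hut)
      ((hωw u hu t ht hut).trans (hw.mono_left hs hu ht hsu hut)) hγ.le
    have h4 : a s u ≤ L * w s t := h2.2.trans (mul_le_mul_of_nonneg_left
      ((hvw s hs u hu hsu).trans (hw.mono_right hs hu ht hsu hut)) (by linarith))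
    have h5 : w s t ^ (1 / p) * w s t ≤ w s t ^ (3 / p) := by
      rcases hw0.eq_or_lt with h | h
      · rw [← h]; simp [Real.zero_rpow (show 3 / p ≠ 0 by positivity)]
      · calc w s t ^ (1 / p) * w s t = w s t ^ (1 / p + 1) := by
              rw [Real.rpow_add h, Real.rpow_one]
          _ ≤ w s t ^ (3 / p) := Real.rpow_le_rpow_of_exponent_ge h (hW.trans hε1) hθ2
    calc _ ≤ C * ω u t ^ (1 / p) * a s u := h1
      _ ≤ C * w s t ^ (1 / p) * (L * w s t) := by gcongr; exact h2.1
      _ = C * L * (w s t ^ (1 / p) * w s t) := by ring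
      _ ≤ C * L * w s t ^ (3 / p) := by gcongr
      _ ≤ (L + C * L) * w s t ^ (3 / p) := mul_le_mul_of_nonneg_right (by linarith)
          (Real.rpow_nonneg hw0 _)
  have haw : ∀ s ∈ Icc 0 T, ∀ t ∈ Icc 0 T, s ≤ t → |a s t| ≤ (L + C * L) * w s t := by
    intro s hs t ht hst
    rw [abs_of_nonneg (ha s hs t ht hst).1]
    calc a s t ≤ L * (v t - v s) := (ha s hs t ht hst).2
      _ ≤ L * w s t := mul_le_mul_of_nonneg_left (hvw s hs t ht hst) (by linarith)
      _ ≤ (L + C * L) * w s t := mul_le_mul_of_nonneg_right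
          (le_add_of_nonneg_right (by positivity)) (hw.nonneg s hs t ht hst)
  obtain ⟨m, e, he, heε, he1, D, hD0, hm0, hm⟩ :=
    exists_additive_sewing hw hwr hT hθ (by positivity) hε haw hδa
  obtain ⟨δ, hδ, hδe⟩ := hwr.exists_le he
  -- The increments of `m` are those of the nonnegative `a` up to superlinear errors, which do not
  -- accumulate.
  have hm_le : ∀ s ∈ Icc 0 T, ∀ t ∈ Icc 0 T, s ≤ t → m s ≤ m t := by
    refine interval_concat_induction hδ (fun s hs t ht hst hd => ?_)
      fun s _ u _ t _ _ _ h1 h2 => h1.trans h2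
    have hsub : Icc s t ⊆ Icc 0 T := Icc_subset_Icc hs.1 ht.2
    refine le_of_sub_ge_neg_rpow hst (hw.subset hsub) (hwr.subset hsub) hD0 hθ
      fun x hx z hz hxz => ?_
    have h1 := hm x (hsub hx) z (hsub hz) hxz
      (hδe x (hsub hx) z (hsub hz) hxz (by linarith [hx.1, hz.2]))
    have h2 := (ha x (hsub hx) z (hsub hz) hxz).1
    linarith [(abs_le.1 h1).1]
  have hm_const : ∀ s ∈ Icc 0 T, ∀ t ∈ Icc 0 T, s ≤ t → v t = v s → m t ≤ m s := by
    refine interval_concat_induction hδ (fun s hs t ht hst hd hv => ?_)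
      fun s hs u hu t ht hsu hut h1 h2 hv => ?_
    · have hsub : Icc s t ⊆ Icc 0 T := Icc_subset_Icc hs.1 ht.2
      refine neg_le_neg_iff.1 (le_of_sub_ge_neg_rpow (g := fun t => - m t) hst (hw.subset hsub)
        (hwr.subset hsub) hD0 hθ fun x hx z hz hxz => ?_)
      have h1 := hm x (hsub hx) z (hsub hz) hxz
        (hδe x (hsub hx) z (hsub hz) hxz (by linarith [hx.1, hz.2]))
      have h2 := (ha x (hsub hx) z (hsub hz) hxz).2
      have h3 := hvmono hs (hsub hx) hx.1
      have h4 := hvmono (hsub hz) ht hz.2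
      have h5 : L * (v z - v x) ≤ 0 := mul_nonpos_of_nonneg_of_nonpos (by linarith) (by linarith)
      linarith [(abs_le.1 h1).2]
    · have h3 := hvmono hs hu hsu
      have h4 := hvmono hu ht hut
      exact (h2 (by linarith)).trans (h1 (by linarith))
  have hm_mono : MonotoneOn m (Icc 0 T) := fun s hs t ht hst => hm_le s hs t ht hst
  have hmw : ∀ s ∈ Icc 0 T, ∀ t ∈ Icc 0 T, s ≤ t → |m t - m s| ≤ (L + C * L + D) * w s t := by
    refine interval_concat_induction hδ (fun s hs t ht hst hd => ?_)
      fun s hs u hu t ht hsu hut h1 h2 => ?_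
    · have hW := hδe s hs t ht hst hd
      have h0 := hw.nonneg s hs t ht hst
      have h1 := hm s hs t ht hst hW
      have h2 := haw s hs t ht hst
      have h3 : w s t ^ (3 / p) ≤ w s t := by
        have := Real.rpow_le_rpow_of_exponent_ge_of_imp h0 (hW.trans he1) hθ.le
          (fun _ h => absurd h (zero_lt_one.trans hθ).ne')
        rwa [Real.rpow_one] at this
      have h4 := mul_le_mul_of_nonneg_left h3 hD0
      have h5 := abs_add_le (m t - m s - a s t) (a s t)
      rw [sub_add_cancel] at h5
      linarith
    · have h3 := hw.superadd s hs u hu t ht hsu hut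
      have h4 := abs_sub_le (m t) (m u) (m s)
      have h5 := mul_le_mul_of_nonneg_left h3 (show 0 ≤ L + C * L + D by positivity)
      linarith
  have hm_mem : MemV1 1 (Icc 0 T) m := by
    have h0 : 0 ≤ L + C * L + D := by positivity
    refine memV1_of_control zero_le_one hT (hw.const_mul h0) (hwr.const_mul h0)
      fun s hs t ht hst => ?_
    rw [Real.rpow_one]
    exact hmw s hs t ht hst
  have hmcont := hm_mem.continuousOn one_pos
  refine ⟨y, m, hy_mem, hy_nonneg, hm_mem, fun t ht => hm0 ▸ hm_le 0 h0T t ht ht.1, hm_mono,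
    hy_init, ?_, ?_⟩
  · -- the dynamics
    refine ⟨fun s t => (y t - y s) - (f (y s) (X1 s t) + secondOrder f (y s) (X2 s t)) -
      (m t - m s), ?_, fun s _ t _ _ => by simp only [incr]; ring⟩
    -- Pieces of length `δ / 2` keep `w ≤ e`, the range in which both the sewing estimate for `m`
    -- and the expansion of the flow hold.
    refine ⟨fun k => Icc (k * (δ / 2)) ((k + 1) * (δ / 2)) ∩ Icc 0 T,
      fun k => ⟨ordConnected_Icc.inter ordConnected_Icc, inter_subset_right⟩, fun t ht => ?_,
      fun k => ⟨fun s hs => ?_, fun t ht => ?_, ?_⟩⟩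
    · have hδ2 : 0 < δ / 2 := by positivity
      refine mem_iUnion.2 ⟨⌊t / (δ / 2)⌋₊, ⟨?_, ?_⟩, ht⟩
      · exact (le_div_iff₀ hδ2).1 (Nat.floor_le (div_nonneg ht.1 hδ2.le))
      · exact ((div_lt_iff₀ hδ2).1 (Nat.lt_floor_add_one _)).le
    · have hsub : (Icc (k * (δ / 2)) ((k + 1) * (δ / 2)) ∩ Icc 0 T) ∩ Ici s ⊆
          Icc 0 T ∩ Ici s := inter_subset_inter_left _ inter_subset_right
      have hsub' := hsub.trans (inter_subset_left : Icc 0 T ∩ Ici s ⊆ Icc 0 T)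
      exact hasOneSidedLimits_remainder hf hf'
        ((hycont.mono hsub').sub continuousOn_const).hasOneSidedLimits
        continuousOn_const.hasOneSidedLimits
        ((hmcont.mono hsub').sub continuousOn_const).hasOneSidedLimits
        ((hX.mem_one.1 s hs.2).mono hsub) ((hX.mem_two.1 s hs.2).mono hsub)
    · have hsub : (Icc (k * (δ / 2)) ((k + 1) * (δ / 2)) ∩ Icc 0 T) ∩ Iic t ⊆
          Icc 0 T ∩ Iic t := inter_subset_inter_left _ inter_subset_right
      have hsub' := hsub.trans (inter_subset_left : Icc 0 T ∩ Iic t ⊆ Icc 0 T)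
      exact hasOneSidedLimits_remainder hf hf'
        (continuousOn_const.sub (hycont.mono hsub')).hasOneSidedLimits
        (hycont.mono hsub').hasOneSidedLimits
        (continuousOn_const.sub (hmcont.mono hsub')).hasOneSidedLimits
        ((hX.mem_one.2.1 t ht.2).mono hsub) ((hX.mem_two.2.1 t ht.2).mono hsub)
    -- The remainder is the sewing error of `m` plus the expansion error of `φ`, at most `(D + C) *
    -- w ^ (3/p)`; the constant enters the control as `(D + C) ^ (p/3)`.
    · have hDC : 0 ≤ D + C := by positivity
      have hc : 0 ≤ (D + C) ^ (p / 3) := Real.rpow_nonneg hDC _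
      refine ⟨_, (hw.const_mul hc).subset inter_subset_right,
        (hwr.const_mul hc).subset inter_subset_right, fun s hs t ht hst => ?_⟩
      have hd : t - s < δ := by linarith [hs.1.1, ht.1.2]
      have hW := hδe s hs.2 t ht.2 hst hd
      have h0 := hw.nonneg s hs.2 t ht.2 hst
      have h1 := hm s hs.2 t ht.2 hst hW
      have hωW := hωw s hs.2 t ht.2 hst
      have h2 := hφ.taylor s hs.2 t ht.2 hst (hωW.trans (hW.trans heε)) (y s)
      rw [roughExpansion] at h2
      have h3 : C * ω s t ^ (3 / p) ≤ C * w s t ^ (3 / p) := mul_le_mul_of_nonneg_left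
        (Real.rpow_le_rpow (hω.nonneg s hs.2 t ht.2 hst) hωW (by positivity)) hC
      rw [show 1 / (p / 3) = 3 / p by field_simp, Real.mul_rpow hc h0, ← Real.rpow_mul hDC,
        show p / 3 * (3 / p) = 1 by field_simp, Real.rpow_one, Real.norm_eq_abs]
      simp only [ha_def] at h1
      rw [abs_le] at *
      constructor <;> linarith [h1.1, h1.2, h2.1, h2.2]
  · -- the reflection
    refine isReflectionTerm_of_monotoneOn hT hm_mono hmcont hm0 hycont
      fun s hs t ht hst hne => le_antisymm (hm_const s hs t ht hst ?_) (hm_le s hs t ht hst)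
    -- Where `y` is positive, `v` lies strictly above the transported boundary. The running maximum
    -- therefore does not grow there.
    refine hvconst s hs t ht hst fun u hu => ?_
    have hu' : u ∈ Icc 0 T := ⟨hs.1.trans hu.1, hu.2.trans ht.2⟩
    rw [← hy u hu']
    exact hsm u hu' (lt_of_le_of_ne (hy_nonneg u hu') (hne u hu).symm)

/-- The flow of a rough differential equation on the line without reflection. -/
theorem IsRoughPath.exists_isFlow {d : ℕ} {p T : ℝ} {X1 : ℝ → ℝ → Vec d} {X2 : ℝ → ℝ → Mat d}
    (hX : IsRoughPath p T X1 X2) (hp : 0 < p) (hp3 : p < 3) (hT : 0 ≤ T)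
    {f : ℝ → Vec d →L[ℝ] ℝ} (hf : IsCb 3 f) :
    ∃ ω : ℝ → ℝ → ℝ, IsControl (Icc 0 T) ω ∧ IsRegular (Icc 0 T) ω ∧
      ∃ φ : ℝ → ℝ → ℝ → ℝ, ∃ ε > 0, ε ≤ 1 ∧ ∃ C ≥ 0, ∃ L ≥ 1,
        IsFlow T ω (1 / p) (3 / p) C L ε (roughExpansion f X1 X2) φ := by
  obtain ⟨ω, hω, hr, h1, h2⟩ := hX.exists_control hp
  obtain ⟨K, hK, happ⟩ := hX.exists_isApproxFlow hp hf hω h1 h2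
  obtain ⟨φ, ε, hε, -, hε1, C, hC, L, hL, hφ⟩ := happ.exists_isFlow hT hω hr (by positivity)
    (div_le_div_of_nonneg_right (by norm_num) hp.le) (by rwa [one_lt_div hp]) hK one_pos
  exact ⟨ω, hω, hr, φ, ε, hε, hε1, C, hC, L, hL, hφ⟩

end RRDE

/-! ### The theorem -/

theorem theorem4p2 (d : ℕ) (p T : ℝ) (hp2 : 2 ≤ p) (hp3 : p < 3) (hT : 0 < T)
    (f : ℝ → RRDE.Vec d →L[ℝ] ℝ) (hf : RRDE.IsCb 3 f)
    (X1 : ℝ → ℝ → RRDE.Vec d) (X2 : ℝ → ℝ → RRDE.Mat d)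
    (hX : RRDE.IsGeometricRoughPath p T X1 X2) (y0 : ℝ) (hy0 : 0 < y0) :
    (∃ y m : ℝ → ℝ, RRDE.IsReflectedSolution p T f X1 X2 y0 y m) ∧
    ∀ y m z n : ℝ → ℝ, RRDE.IsReflectedSolution p T f X1 X2 y0 y m →
      RRDE.IsReflectedSolution p T f X1 X2 y0 z n →
      Set.EqOn y z (Set.Icc 0 T) ∧ Set.EqOn m n (Set.Icc 0 T) := by
  have hp : 0 < p := by linarith
  obtain ⟨ω, hω, hr, φ, ε, hε, hε1, C, hC, L, hL, hφ⟩ := hX.1.exists_isFlow hp hp3 hT.le hf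
  have hf' : Continuous (deriv f) := hf.1.continuous_deriv (by norm_num)
  refine ⟨hφ.exists_isReflectedSolution hX.1 hf.1.continuous hf' hp2 hp3 hL hC hε hε1 hω hr hT.le
    hy0, fun y m z n h h' => ?_⟩
  have hyz : Set.EqOn y z (Set.Icc 0 T) := fun t ht => le_antisymm
    (h.le_of_flow h' hφ hp hp3 hL hC hε hω hr ht) (h'.le_of_flow h hφ hp hp3 hL hC hε hω hr ht)
  exact ⟨hyz, fun t ht => le_antisymm (h.reflection_le h' hp hp3 hy0 hyz ht)
    (h'.reflection_le h hp hp3 hy0 hyz.symm ht)⟩
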